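/- Let $\mathbb V=\{0,1\}^\star$ be the set of finite 0-1 words, $\partial\mathbb V=\{0,1\}^\infty$ the set of infinite 0-1 sequences with its Borel $\sigma$-field, $|u|$ the length of $u\in\mathbb V$, and $A_u\subset\partial\mathbb V$ the set of sequences with prefix $u$. A binary tree is a non-empty finite prefix-stable set $x\subset\mathbb V$; its external nodes are the $u\notin x$ whose direct ancestor belongs to $x$ (there are $\#x+1$ of them). For $u\in\mathbb V$ let $\#x(u)$ be the number of nodes of $x$ with prefix $u$. The boundary function of $x$ is $B_x:\partial\mathbb V\to\mathbb N$, $B_x((v_i)_{i\ge1})=\min\{k\ge 1:(v_1,\dots,v_k)\notin x\}$. Let $X=(X_n)_{n\ge1}$ be a BST chain on a probability space $(\Omega,\mathcal A,P)$, i.e. the Markov chain of binary trees with $X_1=\{\emptyset\}$ almost surely such that $X_{n+1}$ is obtained from $X_n$ by adding one of the external nodes of $X_n$, chosen uniformly at random. Let $\mathcal F_n=\sigma(X_1,\dots,X_n)$. Let $\lambda$ be the probability measure on $\partial\mathbb V$ with $\lambda(A_u)=2^{-|u|}$ for all $u\in\mathbb V$, let $L_n=\int B_{X_n}\,d\lambda$,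 $H(n)=\sum_{k=1}^n 1/k$, and $C(t)=1+\frac12(\log t+\log(1-t))$ for $0<t<1$. There is a random probability measure $X_\infty$ on $\partial\mathbb V$ which is the almost sure limit of $X_n$ in the Doob-Martin compactification, i.e., with probability 1, $\#X_n\to\infty$ and $\#X_n(u)/\#X_n\to X_\infty(A_u)$ as $n\to\infty$ for all $u\in\mathbb V$. For any such $X_\infty$, with probability 1, $X_\infty(A_u)>0$ for all $u\in\mathbb V$. With $\xi_u=X_\infty(A_{u0})/X_\infty(A_u)$, the partial sums $\sum_{|u|<k}2^{-|u|}C(\xi_u)$ converge almost surely and in $L^2$ as $k\to\infty$ to a square-integrable random variable $L_\infty$, written $L_\infty=\sum_{u\in\mathbb V}2^{-|u|}C(\xi_u)$. Moreover, $$E[L_\infty\mid\mathcal F_n]=L_n-H(n)\quad\text{almost surely, for all } n\ge 1,$$ and $$L_n-H(n)\to L_\infty\quad\text{with probability 1 as } n\to\infty.$$ -/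

import Mathlib

open MeasureTheory Filter Topology

noncomputable section

namespace BST

/-- The nodes of the complete binary tree: finite 0-1 words (`false` is 0, `true` is 1). -/
abbrev Node : Type := List Bool

/-- The ends of the complete binary tree: infinite 0-1 sequences, with the product (Borel)
`σ`-field. The `k`-th letter, `k = 1, 2, …`, of `v` is `v (k - 1)`. -/
abbrev Ends : Type := ℕ → Bool

/-- The prefix of length `k` of an infinite 0-1 sequence. -/
def endPrefix (v : Ends) (k : ℕ) : Node := List.ofFn (fun i : Fin k => v i)

/-- The set `A_u` of infinite 0-1 sequences with prefix `u`. -/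
def cyl (u : Node) : Set Ends := {v | endPrefix v u.length = u}

/-- Non-empty finite binary trees: finite prefix-stable sets of nodes. -/
@[ext]
structure BinTree where
  nodes : Finset Node
  nonempty : nodes.Nonempty
  prefixStable : ∀ (u : Node) (b : Bool), u ++ [b] ∈ nodes → u ∈ nodes

/-- Sets of trees carry the discrete `σ`-field (there are countably many trees). -/
instance : MeasurableSpace BinTree := ⊤

/-- The tree that consists of the root only. -/
def rootTree : BinTree where
  nodes := {[]}
  nonempty := by simp
  prefixStable := by simp

/-- The external nodes of a tree: the nodes outside it whose direct ancestor is in it. -/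
def external (x : BinTree) : Set Node :=
  {w | w ∉ x.nodes ∧ ∃ (u : Node) (b : Bool), w = u ++ [b] ∧ u ∈ x.nodes}

/-- The number of nodes of the fringe subtree of `x` rooted at `u`, i.e. the number of nodes of `x`
of the form `u ++ v`. -/
def subtreeSize (x : BinTree) (u : Node) : ℕ := (x.nodes.filter (fun w => u <+: w)).card

/-- The boundary function `B_x`: the least `k ∈ {1, 2, …}` such that the prefix of length `k` is not
in `x`. -/
def boundaryFun (x : BinTree) (v : Ends) : ℕ := sInf {k : ℕ | 1 ≤ k ∧ endPrefix v k ∉ x.nodes}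

/-- The fair coin. -/
def coin : Measure Bool := (PMF.uniformOfFintype Bool).toMeasure

instance : IsProbabilityMeasure coin := by unfold coin; infer_instance

/-- The normalized Haar measure on the infinite 0-1 sequences: the law of fair coin tosses. -/
def haarEnds : Measure Ends := Measure.infinitePi (fun _ : ℕ => coin)

instance : IsProbabilityMeasure haarEnds := by unfold haarEnds; infer_instance

/-- Haar measure gives mass `2 ^ (-|u|)` to `A_u`. -/
theorem haarEnds_cyl (u : Node) : haarEnds (cyl u) = (2⁻¹ : ENNReal) ^ u.length := by
  have h : cyl u = Set.pi (Finset.range u.length : Set ℕ) (fun i => {u.getD i false}) := by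
    ext v
    simp only [cyl, endPrefix, Set.mem_ofPred_eq, Set.mem_pi, Finset.coe_range, Set.mem_Iio,
      Set.mem_singleton_iff]
    constructor
    · intro hv i hi
      conv_rhs => rw [← hv]
      simp [List.getD, hi]
    · intro hv
      apply List.ext_getElem (by simp)
      intro i h1 h2
      have := hv i h2
      simp [List.getD, h2] at this
      simp [this]
  rw [h, haarEnds, Measure.infinitePi_pi _ (fun _ _ => MeasurableSet.of_discrete)]
  have hc : ∀ b : Bool, coin {b} = 2⁻¹ := by
    intro b
    rw [coin, PMF.toMeasure_apply_singleton _ _ (MeasurableSet.of_discrete)]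
    simp
  simp [hc]

/-- Transition probabilities of the BST chain: one of the `#x + 1` external nodes of `x` is chosen
uniformly at random and added to `x`. -/
def trans (x y : BinTree) : ENNReal :=
  open Classical in
  if ∃ u ∈ external x, y.nodes = insert u x.nodes then ((x.nodes.card + 1 : ℕ) : ENNReal)⁻¹ else 0

/-- `(X n)`, `n = 1, 2, …`, is a BST chain: the Markov chain that starts at the root tree at time 1
and has the transition probabilities `trans`. (`X 0` plays no role.) -/
structure IsBSTChain {Ω : Type*} [MeasurableSpace Ω] (P : Measure Ω) (X : ℕ → Ω → BinTree) :
    Prop where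
  measurable : ∀ n, 1 ≤ n → Measurable (X n)
  start : ∀ᵐ ω ∂P, X 1 ω = rootTree
  markov : ∀ n, 1 ≤ n → ∀ x : ℕ → BinTree,
    P {ω | ∀ i ∈ Finset.Icc 1 (n + 1), X i ω = x i} =
      P {ω | ∀ i ∈ Finset.Icc 1 n, X i ω = x i} * trans (x n) (x (n + 1))

/-- The `σ`-field generated by `X 1, …, X n`. -/
abbrev natSigma {Ω : Type*} (X : ℕ → Ω → BinTree) (n : ℕ) : MeasurableSpace Ω :=
  ⨆ i ∈ Finset.Icc 1 n, MeasurableSpace.comap (X i) inferInstance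

/-- Convergence of a sequence of trees to a boundary point of the Doob-Martin compactification,
i.e. to a probability measure on the infinite 0-1 sequences. -/
def DoobMartinTendsto (x : ℕ → BinTree) (μ : ProbabilityMeasure Ends) : Prop :=
  Tendsto (fun n => (x n).nodes.card) atTop atTop ∧
    ∀ u : Node, Tendsto (fun n => (subtreeSize (x n) u : ℝ) / ((x n).nodes.card : ℝ)) atTop
      (𝓝 ((μ : Measure Ends).real (cyl u)))

/-- `ξ_u = μ(A_{u0}) / μ(A_u)`. -/
def xi (μ : ProbabilityMeasure Ends) (u : Node) : ℝ :=
  (μ : Measure Ends).real (cyl (u ++ [false])) / (μ : Measure Ends).real (cyl u)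

/-- `C(t) = 1 + (log t + log (1 - t)) / 2`. -/
def C (t : ℝ) : ℝ := 1 + (1 / 2) * (Real.log t + Real.log (1 - t))

/-- The partial sum `∑_{|u| < k} 2 ^ (-|u|) C(ξ_u)`. -/
def partialL (μ : ProbabilityMeasure Ends) (k : ℕ) : ℝ :=
  ∑ j ∈ Finset.range k, ∑ u : Fin j → Bool, ((2 : ℝ) ^ j)⁻¹ * C (xi μ (List.ofFn u))

/-- `∫ B_x dλ`. -/
def L (x : BinTree) : ℝ := ∫ v, (boundaryFun x v : ℝ) ∂haarEnds

end BST

end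

noncomputable section

namespace BST

/-! ### Combinatorics of finite binary trees -/

/-! Since `B_x(v)` counts the nodes of `x` that are prefixes of `v`, `L x` is the sum of `2^(-|u|)`
over the nodes `u` of `x`. The same expression below a node `u`, centred by `2^(-|u|) H(#x(u))`, is
`fringeDev u`. It splits over the two subtrees of `u`, with sizes `a` and `b`, up to the toll
`2^(-|u|) urnLog a b`. Iterating from the root, `L x - H(#x)` is the sum of the tolls at depth less
than `k` plus a remainder `levelDev k x`.

Everything here is harmonic for the chain. The external nodes below `u` number `#x(u) + 1` and have
total mass `2^(-|u|)`, which makes each `fringeDev u` a martingale. A new node affects at most one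
subtree per level, so the squares of the increments of `levelDev k` add up without cross terms. They
are dominated by the growth of `levelMass k ≤ 2 * 2^(-k)`, which gives `E[levelDev k (X n)^2] ≤ 2 *
2^(-k)` uniformly in `n`.

For fixed `k`, let `n` tend to infinity. The tolls are Pólya urn martingales with `1 - urnLog ≥ 0`,
so they converge. A finite limit prevents either share from degenerating, and then `H(m) = log m + γ
+ o(1)` identifies the limit as `C(ξ_u)`. The case `k = 0` is an `L²`-bounded martingale with limit
`L_∞`, whose conditional expectations are `L_n - H(n)`. By Fatou, the partial sums differ from `L_∞`
by at most `(2 * 2^(-k))^(1/2)` in `L²`; summability over `k` of the second moments yields almost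
sure convergence as well.

The limit measure comes from compactness of the probability measures on the ends: the convergent
relative subtree sizes determine every cluster point of the empirical node measures. -/

theorem BinTree.mem_of_prefix (x : BinTree) {u v : Node} (h : u <+: v) (hv : v ∈ x.nodes) :
    u ∈ x.nodes := by
  obtain ⟨t, rfl⟩ := h
  induction t using List.reverseRecOn with
  | nil => simpa using hv
  | append_singleton t b ih =>
    exact ih (x.prefixStable _ b (by simpa using hv))

theorem prefix_append_singleton_iff {u w : Node} {b : Bool} :
    u <+: w ++ [b] ↔ u = w ++ [b] ∨ u <+: w := List.prefix_concat_iff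

theorem prefix_cases {u w : Node} :
    u <+: w ↔ w = u ∨ u ++ [false] <+: w ∨ u ++ [true] <+: w := by
  constructor
  · rintro ⟨t, rfl⟩
    rcases t with _ | ⟨b, t⟩
    · simp
    · right
      cases b
      · left; exact ⟨t, by simp⟩
      · right; exact ⟨t, by simp⟩
  · rintro (rfl | h | h)
    · exact List.prefix_rfl
    · exact (List.prefix_append _ _).trans h
    · exact (List.prefix_append _ _).trans h

theorem eq_of_prefix_of_length_eq {u v w : Node} (hu : u <+: w) (hv : v <+: w)
    (h : u.length = v.length) : u = v := by
  rw [List.prefix_iff_eq_take.1 hu, List.prefix_iff_eq_take.1 hv, h]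

theorem not_prefix_both {u w : Node} (h0 : u ++ [false] <+: w) : ¬ u ++ [true] <+: w := by
  intro h1
  have := eq_of_prefix_of_length_eq h0 h1 (by simp)
  simp at this

theorem not_child_prefix_self {u : Node} {b : Bool} : ¬ u ++ [b] <+: u := by
  intro h
  have := h.length_le
  simp at this

/-- The external nodes of a tree as a finite set. -/
def externalNodes (x : BinTree) : Finset Node :=
  (x.nodes ×ˢ (Finset.univ : Finset Bool)).image (fun p => p.1 ++ [p.2]) \ x.nodes

theorem mem_externalNodes {x : BinTree} {w : Node} :
    w ∈ externalNodes x ↔ w ∉ x.nodes ∧ ∃ (u : Node) (b : Bool), w = u ++ [b] ∧ u ∈ x.nodes := by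
  simp only [externalNodes, Finset.mem_sdiff, Finset.mem_image, Finset.mem_product,
    Finset.mem_univ, and_true, Prod.exists]
  constructor
  · rintro ⟨⟨u, b, hu, rfl⟩, h⟩
    exact ⟨h, u, b, rfl, hu⟩
  · rintro ⟨h, u, b, rfl, hu⟩
    exact ⟨⟨u, b, hu, rfl⟩, h⟩

theorem mem_external_iff {x : BinTree} {w : Node} : w ∈ external x ↔ w ∈ externalNodes x := by
  rw [mem_externalNodes]; rfl

theorem not_mem_nodes_of_mem_externalNodes {x : BinTree} {w : Node} (h : w ∈ externalNodes x) :
    w ∉ x.nodes := (mem_externalNodes.1 h).1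

/-- The tree obtained from `x` by adding the external node `w`. -/
def addNode (x : BinTree) (w : Node) : BinTree :=
  if h : w ∈ externalNodes x then
    { nodes := insert w x.nodes
      nonempty := Finset.insert_nonempty _ _
      prefixStable := by
        intro u b hu
        obtain ⟨_, v, c, rfl, hv⟩ := mem_externalNodes.1 h
        rcases Finset.mem_insert.1 hu with hu | hu
        · obtain ⟨rfl, -⟩ := List.append_inj' hu rfl
          exact Finset.mem_insert_of_mem hv
        · exact Finset.mem_insert_of_mem (x.prefixStable u b hu) }
  else x

theorem addNode_nodes {x : BinTree} {w : Node} (h : w ∈ externalNodes x) :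
    (addNode x w).nodes = insert w x.nodes := by
  rw [addNode, dif_pos h]

theorem addNode_injOn (x : BinTree) : Set.InjOn (addNode x) (externalNodes x) := by
  intro w hw w' hw' h
  have h' := congrArg BinTree.nodes h
  rw [addNode_nodes hw, addNode_nodes hw'] at h'
  have : w ∈ insert w' x.nodes := h' ▸ Finset.mem_insert_self _ _
  exact (Finset.mem_insert.1 this).resolve_right (not_mem_nodes_of_mem_externalNodes hw)

/-- The nodes of `x` with prefix `u`. -/
def below (x : BinTree) (u : Node) : Finset Node := x.nodes.filter (fun w => u <+: w)

/-- The external nodes of `x` with prefix `u`. -/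
def externalBelow (x : BinTree) (u : Node) : Finset Node :=
  (externalNodes x).filter (fun w => u <+: w)

theorem card_below (x : BinTree) (u : Node) : (below x u).card = subtreeSize x u := rfl

theorem below_eq_empty {x : BinTree} {u : Node} (h : u ∉ x.nodes) : below x u = ∅ := by
  rw [below, Finset.filter_eq_empty_iff]
  intro v hv huv
  exact h (x.mem_of_prefix huv hv)

theorem subtreeSize_eq_zero {x : BinTree} {u : Node} (h : u ∉ x.nodes) : subtreeSize x u = 0 := by
  rw [← card_below, below_eq_empty h, Finset.card_empty]

theorem subtreeSize_nil (x : BinTree) : subtreeSize x [] = x.nodes.card := by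
  simp [subtreeSize]

theorem sum_below_addNode {x : BinTree} {w : Node} (h : w ∈ externalNodes x) (u : Node)
    (f : Node → ℝ) :
    ∑ v ∈ below (addNode x w) u, f v = ∑ v ∈ below x u, f v + if u <+: w then f w else 0 := by
  rw [below, addNode_nodes h, Finset.filter_insert]
  split_ifs with huw
  · rw [Finset.sum_insert, add_comm, below]
    simp [not_mem_nodes_of_mem_externalNodes h]
  · rw [add_zero, below]

theorem subtreeSize_addNode {x : BinTree} {w : Node} (h : w ∈ externalNodes x) (u : Node) :
    subtreeSize (addNode x w) u = subtreeSize x u + if u <+: w then 1 else 0 := by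
  have := sum_below_addNode h u (fun _ => 1)
  simp only [Finset.sum_const, card_below, nsmul_eq_mul, mul_one] at this
  exact_mod_cast this

theorem card_addNode {x : BinTree} {w : Node} (h : w ∈ externalNodes x) :
    (addNode x w).nodes.card = x.nodes.card + 1 := by
  rw [← subtreeSize_nil, ← subtreeSize_nil, subtreeSize_addNode h]
  simp

theorem sum_below_split {x : BinTree} {u : Node} (hu : u ∈ x.nodes) (f : Node → ℝ) :
    ∑ v ∈ below x u, f v =
      f u + ∑ v ∈ below x (u ++ [false]), f v + ∑ v ∈ below x (u ++ [true]), f v := by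
  have h : below x u = insert u (below x (u ++ [false]) ∪ below x (u ++ [true])) := by
    ext v
    simp only [below, Finset.mem_filter, Finset.mem_insert, Finset.mem_union]
    rw [prefix_cases]
    constructor
    · tauto
    · rintro (rfl | h)
      · tauto
      · tauto
  rw [h, Finset.sum_insert, Finset.sum_union, add_assoc]
  · rw [Finset.disjoint_left]
    intro v h0 h1
    exact not_prefix_both (Finset.mem_filter.1 h0).2 (Finset.mem_filter.1 h1).2
  · simp only [below, Finset.mem_union, Finset.mem_filter, not_or, not_and]
    exact ⟨fun _ => not_child_prefix_self, fun _ => not_child_prefix_self⟩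

theorem subtreeSize_split {x : BinTree} {u : Node} (hu : u ∈ x.nodes) :
    subtreeSize x u = subtreeSize x (u ++ [false]) + subtreeSize x (u ++ [true]) + 1 := by
  have := sum_below_split hu (fun _ => 1)
  simp only [Finset.sum_const, card_below, nsmul_eq_mul, mul_one] at this
  have h : (subtreeSize x u : ℝ) =
    ((subtreeSize x (u ++ [false]) + subtreeSize x (u ++ [true]) + 1 : ℕ) : ℝ) := by
    push_cast; linarith
  exact_mod_cast h

/-- The children of the nodes below `u` are, without repetition, the external nodes below `u`
together with the internal ones other than `u`. Taking `f` to be `1`, `2^(-|v|)` and `4^(-|v|)`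
gives all the counts and mass bounds needed later. -/
theorem sum_externalBelow {x : BinTree} {u : Node} (hu : u ∈ x.nodes) (f : Node → ℝ) :
    ∑ w ∈ externalBelow x u, f w =
      ∑ v ∈ below x u, (f (v ++ [false]) + f (v ++ [true]) - f v) + f u := by
  have h : (below x u ×ˢ (Finset.univ : Finset Bool)).image (fun p => p.1 ++ [p.2]) =
      externalBelow x u ∪ (below x u).erase u := by
    ext w
    simp only [below, externalBelow, mem_externalNodes, Finset.mem_image, Finset.mem_product,
      Finset.mem_filter, Finset.mem_univ, and_true, Prod.exists, Finset.mem_union, Finset.mem_erase]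
    constructor
    · rintro ⟨v, b, ⟨hv, huv⟩, rfl⟩
      have h1 : u <+: v ++ [b] := huv.trans (List.prefix_append _ _)
      by_cases hm : v ++ [b] ∈ x.nodes
      · right
        refine ⟨?_, hm, h1⟩
        rintro rfl
        exact not_child_prefix_self huv
      · left
        exact ⟨⟨hm, v, b, rfl, hv⟩, h1⟩
    · rintro (⟨⟨hm, v, b, rfl, hv⟩, h1⟩ | ⟨hne, hm, h1⟩)
      · rcases prefix_append_singleton_iff.1 h1 with rfl | h1
        · exact absurd hu hm
        · exact ⟨v, b, ⟨hv, h1⟩, rfl⟩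
      · induction w using List.reverseRecOn with
        | nil => exact absurd (List.prefix_nil.1 h1).symm hne
        | append_singleton v b _ =>
          rcases prefix_append_singleton_iff.1 h1 with rfl | h1
          · exact absurd rfl hne
          · exact ⟨v, b, ⟨x.prefixStable _ _ hm, h1⟩, rfl⟩
  have hd : Disjoint (externalBelow x u) ((below x u).erase u) := by
    rw [Finset.disjoint_left]
    intro v h0 h1
    exact not_mem_nodes_of_mem_externalNodes (Finset.mem_filter.1 h0).1
      (Finset.mem_filter.1 (Finset.mem_of_mem_erase h1)).1
  have h1 := Finset.sum_union (f := f) hd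
  rw [← h, Finset.sum_image, Finset.sum_product] at h1
  · have hmem : u ∈ below x u := Finset.mem_filter.2 ⟨hu, List.prefix_rfl⟩
    have h2 := Finset.add_sum_erase _ f hmem
    simp only [Fintype.sum_bool] at h1
    rw [Finset.sum_sub_distrib]
    simp only [Finset.sum_add_distrib] at h1 ⊢
    linarith
  · intro p _ q _ hpq
    obtain ⟨h1, h2⟩ := List.append_inj' hpq rfl
    exact Prod.ext h1 (by simpa using h2)

theorem externalBelow_of_not_mem {x : BinTree} {u : Node} (hu : u ∉ x.nodes) :
    externalBelow x u = if u ∈ externalNodes x then {u} else ∅ := by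
  have key : ∀ w ∈ externalBelow x u, w = u := by
    intro w hw
    obtain ⟨hw, huw⟩ := Finset.mem_filter.1 hw
    obtain ⟨_, v, b, rfl, hv⟩ := mem_externalNodes.1 hw
    rcases prefix_append_singleton_iff.1 huw with h | h
    · exact h.symm
    · exact absurd (x.mem_of_prefix h hv) hu
  split_ifs with h
  · ext w
    rw [Finset.mem_singleton]
    refine ⟨key w, ?_⟩
    rintro rfl
    exact Finset.mem_filter.2 ⟨h, List.prefix_rfl⟩
  · rw [Finset.eq_empty_iff_forall_notMem]
    intro w hw
    obtain rfl := key w hw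
    exact h (Finset.mem_filter.1 hw).1

/-- Either no single step can change the subtree at `u`, or `u` is internal or external and both the
node count and Kraft's equality hold. -/
theorem externalBelow_cases (x : BinTree) (u : Node) : externalBelow x u = ∅ ∨
    ((externalBelow x u).card = subtreeSize x u + 1 ∧
      ∑ w ∈ externalBelow x u, (2⁻¹ : ℝ) ^ w.length = 2⁻¹ ^ u.length) := by
  by_cases hu : u ∈ x.nodes
  · right
    constructor
    · have := sum_externalBelow hu (fun _ => 1)
      simp only [Finset.sum_const, nsmul_eq_mul, card_below] at this
      have h : ((externalBelow x u).card : ℝ) = (subtreeSize x u + 1 : ℕ) := by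
        push_cast; linarith
      exact_mod_cast h
    · rw [sum_externalBelow hu, Finset.sum_eq_zero, zero_add]
      intro v _
      simp only [List.length_append, List.length_singleton, pow_succ]
      ring
  · rw [externalBelow_of_not_mem hu]
    split_ifs
    · right
      simp [subtreeSize_eq_zero hu]
    · left; rfl

theorem card_externalBelow_child {x : BinTree} {u : Node} (hu : u ∈ x.nodes) (b : Bool) :
    (externalBelow x (u ++ [b])).card = subtreeSize x (u ++ [b]) + 1 := by
  by_cases hm : u ++ [b] ∈ x.nodes
  · rcases externalBelow_cases x (u ++ [b]) with h | h
    · have := sum_externalBelow hm (fun _ => 1)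
      simp only [Finset.sum_const, nsmul_eq_mul, card_below, h, Finset.card_empty] at this
      have h0 : (0 : ℝ) ≤ subtreeSize x (u ++ [b]) := Nat.cast_nonneg _
      push_cast at this
      linarith
    · exact h.1
  · rw [externalBelow_of_not_mem hm, if_pos (mem_externalNodes.2 ⟨hm, u, b, rfl, hu⟩)]
    simp [subtreeSize_eq_zero hm]

theorem externalBelow_child_of_not_mem {x : BinTree} {u : Node} (hu : u ∉ x.nodes) (b : Bool) :
    externalBelow x (u ++ [b]) = ∅ := by
  rw [externalBelow_of_not_mem (fun h => hu (x.prefixStable u b h)), if_neg]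
  intro h
  obtain ⟨_, v, c, hv, hvx⟩ := mem_externalNodes.1 h
  obtain ⟨rfl, -⟩ := List.append_inj' hv rfl
  exact hu hvx

theorem nil_mem (x : BinTree) : [] ∈ x.nodes := by
  obtain ⟨v, hv⟩ := x.nonempty
  exact x.mem_of_prefix (List.nil_prefix) hv

theorem card_externalNodes (x : BinTree) : (externalNodes x).card = x.nodes.card + 1 := by
  have h : externalNodes x = externalBelow x [] := by simp [externalBelow]
  have h1 := sum_externalBelow (nil_mem x) (fun _ => 1)
  simp only [Finset.sum_const, nsmul_eq_mul, card_below, subtreeSize_nil] at h1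
  rw [h]
  have h2 : ((externalBelow x []).card : ℝ) = (x.nodes.card + 1 : ℕ) := by
    push_cast; linarith
  exact_mod_cast h2

theorem sum_ite_externalNodes (x : BinTree) (u : Node) (f : Node → ℝ) :
    ∑ w ∈ externalNodes x, (if u <+: w then f w else 0) = ∑ w ∈ externalBelow x u, f w := by
  rw [externalBelow, Finset.sum_filter]

/-! ### Harmonic and superharmonic functions on the set of trees -/

/-- Functions of the sizes of two sibling subtrees inherit the harmonicity of Pólya's urn. -/
theorem sum_urn_eq_zero {φ : ℕ → ℕ → ℝ}
    (hφ : ∀ a b : ℕ, ((a : ℝ) + 1) * φ (a + 1) b + (b + 1) * φ a (b + 1) = (a + b + 2) * φ a b)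
    (x : BinTree) (u : Node) :
    ∑ w ∈ externalNodes x,
      (φ (subtreeSize (addNode x w) (u ++ [false])) (subtreeSize (addNode x w) (u ++ [true])) -
        φ (subtreeSize x (u ++ [false])) (subtreeSize x (u ++ [true]))) = 0 := by
  set a := subtreeSize x (u ++ [false]) with ha
  set b := subtreeSize x (u ++ [true]) with hb
  have h : ∀ w ∈ externalNodes x,
      (φ (subtreeSize (addNode x w) (u ++ [false])) (subtreeSize (addNode x w) (u ++ [true])) -
        φ a b) = (if u ++ [false] <+: w then φ (a + 1) b - φ a b else 0) +
          (if u ++ [true] <+: w then φ a (b + 1) - φ a b else 0) := by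
    intro w hw
    rw [subtreeSize_addNode hw, subtreeSize_addNode hw, ← ha, ← hb]
    by_cases h0 : u ++ [false] <+: w
    · simp [h0, not_prefix_both h0]
    · by_cases h1 : u ++ [true] <+: w <;> simp [h0, h1]
  rw [Finset.sum_congr rfl h, Finset.sum_add_distrib, sum_ite_externalNodes,
    sum_ite_externalNodes, Finset.sum_const, Finset.sum_const]
  by_cases hu : u ∈ x.nodes
  · rw [card_externalBelow_child hu, card_externalBelow_child hu, ← ha, ← hb]
    have := hφ a b
    simp only [nsmul_eq_mul]
    push_cast
    linarith
  · simp [externalBelow_child_of_not_mem hu]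

/-- The share of the left subtree, counted in external nodes. -/
def urnShare (a b : ℕ) : ℝ := ((a : ℝ) + 1) / (a + b + 2)

theorem urnShare_harmonic (a b : ℕ) : ((a : ℝ) + 1) * urnShare (a + 1) b +
    (b + 1) * urnShare a (b + 1) = (a + b + 2) * urnShare a b := by
  unfold urnShare
  have h1 : ((a : ℝ) + b + 2) ≠ 0 := by positivity
  have h2 : ((a : ℝ) + 1 + b + 2) ≠ 0 := by positivity
  have h3 : ((a : ℝ) + (b + 1) + 2) ≠ 0 := by positivity
  push_cast
  field_simp
  ring

/-- The conditional mean of `C (ξ_u)` given the sizes of the two subtrees of `u`. -/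
def urnLog (a b : ℕ) : ℝ :=
  1 + (1 / 2) * ((harmonic a : ℝ) + harmonic b) - harmonic (a + b + 1)

/-- Weighted by `a + 1` and `b + 1`, the increments of `H(a)/2` and `H(b)/2` contribute `1/2` each;
the increment of `H(a + b + 1)`, weighted by `a + b + 2`, cancels them. -/
theorem urnLog_harmonic (a b : ℕ) : ((a : ℝ) + 1) * urnLog (a + 1) b +
    (b + 1) * urnLog a (b + 1) = (a + b + 2) * urnLog a b := by
  unfold urnLog
  have e1 : a + 1 + b + 1 = a + b + 1 + 1 := by ring
  have e2 : a + (b + 1) + 1 = a + b + 1 + 1 := by ring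
  rw [e1, e2, harmonic_succ a, harmonic_succ b, harmonic_succ (a + b + 1)]
  push_cast
  have h1 : ((a : ℝ) + b + 1 + 1) ≠ 0 := by positivity
  have h2 : ((a : ℝ) + 1) ≠ 0 := by positivity
  have h3 : ((b : ℝ) + 1) ≠ 0 := by positivity
  field_simp
  ring

/-- The contribution of the fringe subtree at `u` to `L x - H (#x)`. -/
def fringeDev (u : Node) (x : BinTree) : ℝ :=
  ∑ v ∈ below x u, (2⁻¹ : ℝ) ^ v.length - 2⁻¹ ^ u.length * harmonic (subtreeSize x u)

theorem fringeDev_split (u : Node) (x : BinTree) :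
    fringeDev u x = fringeDev (u ++ [false]) x + fringeDev (u ++ [true]) x +
      2⁻¹ ^ u.length * urnLog (subtreeSize x (u ++ [false])) (subtreeSize x (u ++ [true])) := by
  unfold fringeDev urnLog
  simp only [List.length_append, List.length_singleton, pow_succ]
  by_cases hu : u ∈ x.nodes
  · rw [sum_below_split hu, subtreeSize_split hu]
    ring
  -- Outside the tree every term vanishes, the toll included: `urnLog 0 0 = 1 - H(1) = 0`.
  · have h : ∀ b, u ++ [b] ∉ x.nodes := fun b h => hu (x.prefixStable u b h)
    simp [below_eq_empty hu, below_eq_empty (h _), subtreeSize_eq_zero hu,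
      subtreeSize_eq_zero (h _)]

/-! ### One-step increments and second moments of the deviations. -/

theorem fringeDev_addNode {x : BinTree} {w : Node} (h : w ∈ externalNodes x) (u : Node) :
    fringeDev u (addNode x w) - fringeDev u x =
      if u <+: w then 2⁻¹ ^ w.length - 2⁻¹ ^ u.length / ((subtreeSize x u : ℝ) + 1) else 0 := by
  unfold fringeDev
  rw [sum_below_addNode h, subtreeSize_addNode h]
  split_ifs
  · rw [harmonic_succ]
    push_cast
    rw [div_eq_mul_inv]
    ring
  · simp

/-- The subtracted constant is exactly the mean of `2^(-|w|)` over the external nodes `w` below `u`.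
-/
theorem sum_fringeDev_addNode (x : BinTree) (u : Node) :
    ∑ w ∈ externalNodes x, (fringeDev u (addNode x w) - fringeDev u x) = 0 := by
  rw [Finset.sum_congr rfl (fun w hw => fringeDev_addNode hw u), sum_ite_externalNodes,
    Finset.sum_sub_distrib, Finset.sum_const]
  rcases externalBelow_cases x u with h | ⟨h1, h2⟩
  · simp [h]
  · rw [h1, h2, nsmul_eq_mul]
    have : ((subtreeSize x u : ℝ) + 1) ≠ 0 := by positivity
    push_cast
    field_simp
    ring

/-- The left side is a sum of squared deviations from the mean, hence at most the uncentred sum of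
squares. -/
theorem sum_fringeDev_addNode_sq_le (x : BinTree) (u : Node) :
    ∑ w ∈ externalNodes x, (fringeDev u (addNode x w) - fringeDev u x) ^ 2 ≤
      ∑ w ∈ externalBelow x u, (4⁻¹ : ℝ) ^ w.length := by
  have h0 : ∀ w ∈ externalNodes x, (fringeDev u (addNode x w) - fringeDev u x) ^ 2 =
      if u <+: w then (2⁻¹ ^ w.length - 2⁻¹ ^ u.length / ((subtreeSize x u : ℝ) + 1)) ^ 2
        else 0 := by
    intro w hw
    rw [fringeDev_addNode hw]
    split_ifs <;> simp
  rw [Finset.sum_congr rfl h0, sum_ite_externalNodes]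
  rcases externalBelow_cases x u with h | ⟨h1, h2⟩
  · simp [h]
  · set m : ℝ := 2⁻¹ ^ u.length / ((subtreeSize x u : ℝ) + 1) with hm
    have hN : ((subtreeSize x u : ℝ) + 1) ≠ 0 := by positivity
    have h3 : ∀ w : Node, ((2⁻¹ : ℝ) ^ w.length - m) ^ 2 =
        4⁻¹ ^ w.length - (2 * m) * 2⁻¹ ^ w.length + m ^ 2 := by
      intro w
      have : (4⁻¹ : ℝ) = 2⁻¹ ^ 2 := by norm_num
      rw [this, ← pow_mul, mul_comm 2, pow_mul]
      ring
    simp only [h3]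
    rw [Finset.sum_add_distrib, Finset.sum_sub_distrib, ← Finset.mul_sum, h2, Finset.sum_const, h1,
      nsmul_eq_mul]
    have h4 : (2⁻¹ : ℝ) ^ u.length = m * ((subtreeSize x u : ℝ) + 1) := by
      rw [hm]; field_simp
    rw [h4]
    push_cast
    have h5 : 0 ≤ m ^ 2 * ((subtreeSize x u : ℝ) + 1) := by positivity
    nlinarith

/-- Two children carry half the `4^(-|v|)` of their parent, so in `sum_externalBelow` half of the
internal sum is at most the term at `u`. -/
theorem sum_below_four_le (x : BinTree) (u : Node) :
    ∑ v ∈ below x u, (4⁻¹ : ℝ) ^ v.length ≤ 2 * 4⁻¹ ^ u.length := by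
  by_cases hu : u ∈ x.nodes
  · have h := sum_externalBelow hu (fun v => (4⁻¹ : ℝ) ^ v.length)
    have h0 : 0 ≤ ∑ w ∈ externalBelow x u, (4⁻¹ : ℝ) ^ w.length :=
      Finset.sum_nonneg (fun _ _ => by positivity)
    have h1 : ∀ v : Node, (4⁻¹ : ℝ) ^ (v ++ [false]).length + 4⁻¹ ^ (v ++ [true]).length -
        4⁻¹ ^ v.length = -(1 / 2) * 4⁻¹ ^ v.length := by
      intro v
      simp only [List.length_append, List.length_singleton, pow_succ]
      ring
    simp only [h1, ← Finset.mul_sum] at h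
    linarith
  · rw [below_eq_empty hu]
    simp

/-- The total contribution of the fringe subtrees at depth `k` to `L x - H (#x)`. -/
def levelDev (k : ℕ) (x : BinTree) : ℝ := ∑ u : Fin k → Bool, fringeDev (List.ofFn u) x

/-- The compensator that dominates the square of `levelDev k`. -/
def levelMass (k : ℕ) (x : BinTree) : ℝ :=
  ∑ u : Fin k → Bool, ∑ v ∈ below x (List.ofFn u), (4⁻¹ : ℝ) ^ v.length

theorem levelMass_nonneg (k : ℕ) (x : BinTree) : 0 ≤ levelMass k x :=
  Finset.sum_nonneg (fun _ _ => Finset.sum_nonneg (fun _ _ => by positivity))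

theorem levelMass_le (k : ℕ) (x : BinTree) : levelMass k x ≤ 2 * 2⁻¹ ^ k := by
  calc levelMass k x ≤ ∑ _u : Fin k → Bool, 2 * (4⁻¹ : ℝ) ^ k := by
        refine Finset.sum_le_sum (fun u _ => ?_)
        simpa using sum_below_four_le x (List.ofFn u)
    _ = 2 * 2⁻¹ ^ k := by
        simp only [Finset.sum_const, Finset.card_univ, Fintype.card_fun, Fintype.card_bool,
          Fintype.card_fin, nsmul_eq_mul]
        push_cast
        rw [show (4⁻¹ : ℝ) = 2⁻¹ * 2⁻¹ by norm_num, mul_pow, inv_pow]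
        field_simp

theorem sum_ofFn_succ (k : ℕ) (f : Node → ℝ) :
    ∑ u : Fin (k + 1) → Bool, f (List.ofFn u) =
      ∑ u : Fin k → Bool, (f (List.ofFn u ++ [false]) + f (List.ofFn u ++ [true])) := by
  rw [← (Fin.snocEquiv (fun _ => Bool)).sum_comp, Fintype.sum_prod_type, Finset.sum_comm]
  refine Finset.sum_congr rfl (fun u _ => ?_)
  have h : ∀ b : Bool, List.ofFn (Fin.snocEquiv (fun _ => Bool) (b, u)) = List.ofFn u ++ [b] := by
    intro b
    rw [List.ofFn_succ']
    simp [Fin.snocEquiv]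
  rw [Fintype.sum_bool, h, h, add_comm]

theorem levelDev_succ (k : ℕ) (x : BinTree) :
    levelDev (k + 1) x = levelDev k x - ∑ u : Fin k → Bool, ((2 : ℝ) ^ k)⁻¹ *
      urnLog (subtreeSize x (List.ofFn u ++ [false])) (subtreeSize x (List.ofFn u ++ [true])) := by
  unfold levelDev
  rw [sum_ofFn_succ k (fun u => fringeDev u x), ← Finset.sum_sub_distrib]
  refine Finset.sum_congr rfl (fun u _ => ?_)
  rw [fringeDev_split (List.ofFn u)]
  simp

theorem levelDev_zero_sub (k : ℕ) (x : BinTree) :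
    levelDev 0 x - levelDev k x = ∑ j ∈ Finset.range k, ∑ u : Fin j → Bool, ((2 : ℝ) ^ j)⁻¹ *
      urnLog (subtreeSize x (List.ofFn u ++ [false])) (subtreeSize x (List.ofFn u ++ [true])) := by
  induction k with
  | zero => simp
  | succ k ih => rw [Finset.sum_range_succ, ← ih, levelDev_succ]; ring

theorem sum_levelDev_addNode (k : ℕ) (x : BinTree) :
    ∑ w ∈ externalNodes x, (levelDev k (addNode x w) - levelDev k x) = 0 := by
  simp only [levelDev, ← Finset.sum_sub_distrib]
  rw [Finset.sum_comm]
  exact Finset.sum_eq_zero (fun u _ => sum_fringeDev_addNode x _)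

/-- Only one word of length `k` can be a prefix of `w`, so the cross terms vanish. -/
theorem levelDev_addNode_sq {k : ℕ} {x : BinTree} {w : Node} (hw : w ∈ externalNodes x) :
    (levelDev k (addNode x w) - levelDev k x) ^ 2 =
      ∑ u : Fin k → Bool, (fringeDev (List.ofFn u) (addNode x w) - fringeDev (List.ofFn u) x) ^ 2 := by
  simp only [levelDev, ← Finset.sum_sub_distrib]
  rw [sq, Finset.sum_mul_sum]
  refine Finset.sum_congr rfl (fun u _ => ?_)
  rw [Finset.sum_eq_single u, sq]
  · intro v _ hvu
    rw [fringeDev_addNode hw, fringeDev_addNode hw]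
    split_ifs with h1 h2
    · exact absurd (List.ofFn_injective (eq_of_prefix_of_length_eq h2 h1 (by simp))) hvu
    all_goals simp
  · simp

/-- By harmonicity the mean growth of the square is the mean squared increment. Adding `w` below
level `k` raises `levelMass k` by `4^(-|w|)`, which pays for it. -/
theorem sum_levelDev_sq_sub_levelMass_le (k : ℕ) (x : BinTree) :
    ∑ w ∈ externalNodes x, (levelDev k (addNode x w) ^ 2 - levelMass k (addNode x w)) ≤
      ((x.nodes.card : ℝ) + 1) * (levelDev k x ^ 2 - levelMass k x) := by
  have h1 : ∑ w ∈ externalNodes x, (levelDev k (addNode x w) - levelDev k x) ^ 2 ≤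
      ∑ w ∈ externalNodes x, (levelMass k (addNode x w) - levelMass k x) := by
    rw [Finset.sum_congr rfl (fun w hw => levelDev_addNode_sq hw), Finset.sum_comm]
    simp only [levelMass, ← Finset.sum_sub_distrib]
    rw [Finset.sum_comm (s := externalNodes x)]
    refine Finset.sum_le_sum (fun u _ => ?_)
    refine (sum_fringeDev_addNode_sq_le x _).trans (le_of_eq ?_)
    rw [← sum_ite_externalNodes]
    refine Finset.sum_congr rfl (fun w hw => ?_)
    rw [sum_below_addNode hw]
    ring
  have h2 := sum_levelDev_addNode k x
  have h3 : ∑ w ∈ externalNodes x, (levelDev k (addNode x w) ^ 2 - levelMass k (addNode x w)) =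
      ∑ w ∈ externalNodes x, (levelDev k (addNode x w) - levelDev k x) ^ 2 -
      ∑ w ∈ externalNodes x, (levelMass k (addNode x w) - levelMass k x) +
      2 * levelDev k x * ∑ w ∈ externalNodes x, (levelDev k (addNode x w) - levelDev k x) +
      ∑ w ∈ externalNodes x, (levelDev k x ^ 2 - levelMass k x) := by
    rw [Finset.mul_sum, ← Finset.sum_sub_distrib, ← Finset.sum_add_distrib,
      ← Finset.sum_add_distrib]
    exact Finset.sum_congr rfl (fun w _ => by ring)
  rw [h3, h2, Finset.sum_const, card_externalNodes, nsmul_eq_mul]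
  push_cast
  linarith

theorem levelDev_rootTree (k : ℕ) : levelDev k rootTree = 0 := by
  refine Finset.sum_eq_zero (fun u _ => ?_)
  rcases k with _ | k
  · simp [fringeDev, below, subtreeSize_nil, rootTree]
  · have : List.ofFn u ∉ rootTree.nodes := by
      simp [rootTree]
    rw [fringeDev, below_eq_empty this, subtreeSize_eq_zero this]
    simp

/-! ### The boundary function -/

theorem endPrefix_length (v : Ends) (k : ℕ) : (endPrefix v k).length = k := by simp [endPrefix]

theorem endPrefix_succ (v : Ends) (k : ℕ) : endPrefix v (k + 1) = endPrefix v k ++ [v k] := by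
  rw [endPrefix, List.ofFn_succ']
  simp [endPrefix]

theorem endPrefix_prefix (v : Ends) {j k : ℕ} (h : j ≤ k) : endPrefix v j <+: endPrefix v k := by
  induction k, h using Nat.le_induction with
  | base => exact List.prefix_rfl
  | succ k _ ih => rw [endPrefix_succ]; exact ih.trans (List.prefix_append _ _)

theorem exists_endPrefix_not_mem (x : BinTree) (v : Ends) :
    ∃ k, 1 ≤ k ∧ endPrefix v k ∉ x.nodes := by
  by_contra! h
  have h1 : Set.InjOn (endPrefix v) (Set.Ici 1) := by
    intro i _ j _ hij
    simpa [endPrefix_length] using congrArg List.length hij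
  exact (Set.infinite_of_injOn_mapsTo h1 (fun k hk => h k hk) (Set.Ici_infinite 1))
    (Finset.finite_toSet x.nodes)

theorem endPrefix_mem_iff (x : BinTree) (v : Ends) (k : ℕ) :
    endPrefix v k ∈ x.nodes ↔ k < boundaryFun x v := by
  have hmem := Nat.sInf_mem (exists_endPrefix_not_mem x v)
  change 1 ≤ boundaryFun x v ∧ endPrefix v (boundaryFun x v) ∉ x.nodes at hmem
  constructor
  · intro h
    by_contra! hk
    exact hmem.2 (x.mem_of_prefix (endPrefix_prefix v hk) h)
  · intro h
    rcases Nat.eq_zero_or_pos k with rfl | hk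
    · exact nil_mem x
    · by_contra hn
      exact (Nat.sInf_le (s := {k : ℕ | 1 ≤ k ∧ endPrefix v k ∉ x.nodes}) ⟨hk, hn⟩).not_gt h

theorem isClopen_cyl (u : Node) : IsClopen (cyl u) := by
  have h : Continuous (fun v : Ends => fun i : Fin u.length => v i) :=
    continuous_pi (fun i => continuous_apply _)
  exact (isClopen_discrete {f : Fin u.length → Bool | List.ofFn f = u}).preimage h

theorem measurableSet_cyl (u : Node) : MeasurableSet (cyl u) :=
  (isClopen_cyl u).isOpen.measurableSet

/-- By prefix stability, the prefixes of `v` that lie in `x` are those of lengths `0, …, B_x(v) -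
1`. -/
theorem boundaryFun_eq_sum (x : BinTree) (v : Ends) :
    (boundaryFun x v : ℝ) = ∑ u ∈ x.nodes, (cyl u).indicator 1 v := by
  classical
  have h : (Finset.range (boundaryFun x v)).image (endPrefix v) =
      x.nodes.filter (fun u => v ∈ cyl u) := by
    ext u
    rw [Finset.mem_filter, Finset.mem_image]
    simp only [Finset.mem_range, cyl, Set.mem_ofPred_eq]
    constructor
    · rintro ⟨k, hk, rfl⟩
      exact ⟨(endPrefix_mem_iff x v k).2 hk, by rw [endPrefix_length]⟩
    · rintro ⟨hu, huv⟩
      exact ⟨u.length, (endPrefix_mem_iff x v _).1 (huv.symm ▸ hu), huv⟩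
  have h1 : (Finset.range (boundaryFun x v)).card = (x.nodes.filter (fun u => v ∈ cyl u)).card := by
    rw [← h, Finset.card_image_of_injOn]
    intro i _ j _ hij
    simpa [endPrefix_length] using congrArg List.length hij
  rw [Finset.card_range] at h1
  rw [h1, Finset.card_filter]
  push_cast
  exact Finset.sum_congr rfl (fun u _ => by simp [Set.indicator_apply])

theorem L_eq_sum (x : BinTree) : L x = ∑ u ∈ x.nodes, (2⁻¹ : ℝ) ^ u.length := by
  unfold L
  simp only [boundaryFun_eq_sum]
  rw [integral_finsetSum]
  · refine Finset.sum_congr rfl (fun u _ => ?_)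
    rw [integral_indicator_one (measurableSet_cyl u), measureReal_def, haarEnds_cyl]
    simp
  · intro u _
    exact (integrable_const (1 : ℝ)).indicator (measurableSet_cyl u)

theorem levelDev_zero (x : BinTree) : levelDev 0 x = L x - harmonic x.nodes.card := by
  simp [levelDev, fringeDev, L_eq_sum, below, subtreeSize_nil]

/-! ### One step of the chain -/

instance : Countable BinTree :=
  Function.Injective.countable (f := BinTree.nodes) (fun _ _ h => BinTree.ext h)

instance : DiscreteMeasurableSpace BinTree := ⟨fun _ => trivial⟩

/-- The possible successors of a tree. -/
def children (x : BinTree) : Finset BinTree :=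
  open Classical in (externalNodes x).image (addNode x)

theorem mem_children {x y : BinTree} :
    y ∈ children x ↔ ∃ w ∈ externalNodes x, addNode x w = y := by
  classical
  simp [children]

theorem sum_children_eq (x : BinTree) (g : BinTree → ℝ) :
    ∑ y ∈ children x, g y = ∑ w ∈ externalNodes x, g (addNode x w) := by
  classical
  rw [children, Finset.sum_image (addNode_injOn x)]

theorem card_children (x : BinTree) : (children x).card = x.nodes.card + 1 := by
  classical
  rw [children, Finset.card_image_of_injOn (addNode_injOn x), card_externalNodes]

theorem trans_of_mem_children {x y : BinTree} (h : y ∈ children x) :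
    trans x y = ((x.nodes.card + 1 : ℕ) : ENNReal)⁻¹ := by
  obtain ⟨w, hw, rfl⟩ := mem_children.1 h
  exact if_pos ⟨w, mem_external_iff.2 hw, addNode_nodes hw⟩

/-- The mean of `g` after one step of the chain from `x`. -/
def stepMean (g : BinTree → ℝ) (x : BinTree) : ℝ :=
  ((x.nodes.card : ℝ) + 1)⁻¹ * ∑ w ∈ externalNodes x, g (addNode x w)

theorem stepMean_eq_self {g : BinTree → ℝ} {x : BinTree}
    (h : ∑ w ∈ externalNodes x, (g (addNode x w) - g x) = 0) : stepMean g x = g x := by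
  rw [Finset.sum_sub_distrib, Finset.sum_const, card_externalNodes, nsmul_eq_mul, sub_eq_zero] at h
  rw [stepMean, h]
  push_cast
  exact inv_mul_cancel_left₀ (by positivity) _

/-! ### The conditional law of one step, and martingales along the chain. -/

section Chain

variable {Ω : Type*} {mΩ : MeasurableSpace Ω} {P : Measure Ω} {X : ℕ → Ω → BinTree}

/-- The first `n` trees. -/
def path (X : ℕ → Ω → BinTree) (n : ℕ) (ω : Ω) : Finset.Icc 1 n → BinTree := fun i => X i ω

theorem IsBSTChain.measurable_path (hX : IsBSTChain P X) (n : ℕ) : Measurable (path X n) :=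
  measurable_pi_lambda _ (fun i => hX.measurable i (Finset.mem_Icc.1 i.2).1)

/-- Trees being countable, events of the natural `σ`-field are countable unions of path fibres, so
conditional identities need only be checked on fibres. -/
theorem exists_preimage_path {n : ℕ} {A : Set Ω} (hA : MeasurableSet[natSigma X n] A) :
    ∃ S : Set (Finset.Icc 1 n → BinTree), path X n ⁻¹' S = A := by
  have h : natSigma X n ≤ MeasurableSpace.comap (path X n) ⊤ := by
    refine iSup₂_le (fun i hi => ?_)
    rintro _ ⟨T, _, rfl⟩
    exact ⟨(fun s => s ⟨i, hi⟩) ⁻¹' T, trivial, rfl⟩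
  obtain ⟨S, _, hS⟩ := h A hA
  exact ⟨S, hS⟩

theorem natSigma_le (hX : IsBSTChain P X) (n : ℕ) : natSigma X n ≤ mΩ :=
  iSup₂_le (fun i hi => (hX.measurable i (Finset.mem_Icc.1 hi).1).comap_le)

theorem IsBSTChain.measure_path_inter (hX : IsBSTChain P X) {n : ℕ} (hn : 1 ≤ n)
    (s : Finset.Icc 1 n → BinTree) (y : BinTree) :
    P (path X n ⁻¹' {s} ∩ X (n + 1) ⁻¹' {y}) =
      P (path X n ⁻¹' {s}) * trans (s ⟨n, Finset.mem_Icc.2 ⟨hn, le_rfl⟩⟩) y := by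
  -- The Markov property is stated for full sequences; of the padding outside `1, …, n`, only the
  -- value `y` at `n + 1` matters.
  set x : ℕ → BinTree := fun i => if h : i ∈ Finset.Icc 1 n then s ⟨i, h⟩ else y with hx
  have hx1 : ∀ i (h : i ∈ Finset.Icc 1 n), x i = s ⟨i, h⟩ := fun i h => dif_pos h
  have hx2 : x (n + 1) = y := dif_neg (by simp)
  have h1 : {ω | ∀ i ∈ Finset.Icc 1 n, X i ω = x i} = path X n ⁻¹' {s} := by
    ext ω
    simp only [Set.mem_ofPred_eq, Set.mem_preimage, Set.mem_singleton_iff, funext_iff, path]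
    exact ⟨fun h i => (h i i.2).trans (hx1 i i.2), fun h i hi => (h ⟨i, hi⟩).trans (hx1 i hi).symm⟩
  have h2 : {ω | ∀ i ∈ Finset.Icc 1 (n + 1), X i ω = x i} =
      path X n ⁻¹' {s} ∩ X (n + 1) ⁻¹' {y} := by
    rw [← h1]
    ext ω
    simp only [Set.mem_ofPred_eq, Set.mem_inter_iff, Set.mem_preimage, Set.mem_singleton_iff]
    constructor
    · intro h
      refine ⟨fun i hi => h i ?_, ?_⟩
      · rw [Finset.mem_Icc] at hi ⊢; omega
      · rw [h _ (by simp), hx2]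
    · rintro ⟨h, h'⟩ i hi
      by_cases hin : i ∈ Finset.Icc 1 n
      · exact h i hin
      · obtain rfl : i = n + 1 := by rw [Finset.mem_Icc] at hi hin; omega
        rw [h', hx2]
  rw [← h2, ← h1, hX.markov n hn x, hx2, hx1 n]

theorem IsBSTChain.ae_restrict_mem_children [IsProbabilityMeasure P] (hX : IsBSTChain P X) {n : ℕ}
    (hn : 1 ≤ n) (s : Finset.Icc 1 n → BinTree) :
    ∀ᵐ ω ∂(P.restrict (path X n ⁻¹' {s})),
      X (n + 1) ω ∈ children (s ⟨n, Finset.mem_Icc.2 ⟨hn, le_rfl⟩⟩) := by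
  set x := s ⟨n, Finset.mem_Icc.2 ⟨hn, le_rfl⟩⟩ with hx
  have hXm := hX.measurable (n + 1) (by omega)
  have hA : MeasurableSet (path X n ⁻¹' {s}) := hX.measurable_path n (measurableSet_singleton s)
  have h1 := sum_measure_preimage_singleton (μ := P.restrict (path X n ⁻¹' {s})) (children x)
    (f := X (n + 1)) (fun y _ => hXm (measurableSet_singleton y))
  have h2 : ∀ y ∈ children x, P.restrict (path X n ⁻¹' {s}) (X (n + 1) ⁻¹' {y}) =
      P (path X n ⁻¹' {s}) * ((x.nodes.card + 1 : ℕ) : ENNReal)⁻¹ := by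
    intro y hy
    rw [Measure.restrict_apply (hXm (measurableSet_singleton y)), Set.inter_comm,
      hX.measure_path_inter hn, trans_of_mem_children hy]
  -- The `#x + 1` children of equal probability `1 / (#x + 1)` exhaust the mass of the fibre.
  rw [Finset.sum_congr rfl h2, Finset.sum_const, card_children, nsmul_eq_mul, mul_left_comm,
    ENNReal.mul_inv_cancel (by simp) (by simp), mul_one] at h1
  rw [ae_iff]
  change P.restrict _ (X (n + 1) ⁻¹' (children x : Set BinTree))ᶜ = 0
  rw [measure_compl (hXm (MeasurableSet.of_discrete)) (measure_ne_top _ _), ← h1]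
  simp

theorem IsBSTChain.integral_path [IsProbabilityMeasure P] (hX : IsBSTChain P X) {n : ℕ}
    (hn : 1 ≤ n) (s : Finset.Icc 1 n → BinTree) (g : BinTree → ℝ) :
    ∫ ω in path X n ⁻¹' {s}, g (X (n + 1) ω) ∂P =
      ∫ ω in path X n ⁻¹' {s}, stepMean g (X n ω) ∂P := by
  classical
  set x := s ⟨n, Finset.mem_Icc.2 ⟨hn, le_rfl⟩⟩ with hx
  have hXm := hX.measurable (n + 1) (by omega)
  have hA : MeasurableSet (path X n ⁻¹' {s}) := hX.measurable_path n (measurableSet_singleton s)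
  have h1 : ∫ ω in path X n ⁻¹' {s}, g (X (n + 1) ω) ∂P =
      ∫ ω in path X n ⁻¹' {s}, ∑ y ∈ children x,
        (X (n + 1) ⁻¹' {y}).indicator (fun _ => g y) ω ∂P := by
    refine integral_congr_ae ?_
    filter_upwards [hX.ae_restrict_mem_children hn s] with ω hω
    rw [Finset.sum_eq_single (X (n + 1) ω)]
    · simp
    · intro y _ hy
      rw [Set.indicator_of_notMem]
      exact fun h => hy (Set.mem_singleton_iff.1 h).symm
    · exact fun h => absurd hω h
  have h2 : ∫ ω in path X n ⁻¹' {s}, stepMean g (X n ω) ∂P =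
      ∫ ω in path X n ⁻¹' {s}, stepMean g x ∂P := by
    refine setIntegral_congr_fun hA (fun ω hω => ?_)
    have : X n ω = x := congrFun (Set.mem_singleton_iff.1 hω) ⟨n, Finset.mem_Icc.2 ⟨hn, le_rfl⟩⟩
    simp only [this]
  rw [h1, h2, integral_finsetSum]
  · rw [setIntegral_const, stepMean, ← sum_children_eq, Finset.mul_sum, smul_eq_mul,
      Finset.mul_sum]
    refine Finset.sum_congr rfl (fun y hy => ?_)
    rw [integral_indicator_const _ (hXm (measurableSet_singleton y)), measureReal_def,
      Measure.restrict_apply (hXm (measurableSet_singleton y)), Set.inter_comm,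
      hX.measure_path_inter hn, trans_of_mem_children hy, measureReal_def, ENNReal.toReal_mul,
      ENNReal.toReal_inv, ENNReal.toReal_natCast, smul_eq_mul]
    push_cast
    ring
  · intro y _
    exact (integrable_const (g y)).indicator (hXm (measurableSet_singleton y))

theorem IsBSTChain.ae_mem_children [IsProbabilityMeasure P] (hX : IsBSTChain P X) {n : ℕ}
    (hn : 1 ≤ n) : ∀ᵐ ω ∂P, X (n + 1) ω ∈ children (X n ω) := by
  have h : ∀ s : Finset.Icc 1 n → BinTree, ∀ᵐ ω ∂P, ω ∈ path X n ⁻¹' {s} →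
      X (n + 1) ω ∈ children (s ⟨n, Finset.mem_Icc.2 ⟨hn, le_rfl⟩⟩) := by
    intro s
    rw [← ae_restrict_iff' (hX.measurable_path n (measurableSet_singleton s))]
    exact hX.ae_restrict_mem_children hn s
  rw [← ae_all_iff] at h
  filter_upwards [h] with ω hω
  exact hω (path X n ω) (Set.mem_singleton _)

/-- The trees that can be reached in `n` steps. -/
def reachable : ℕ → Finset BinTree
  | 0 => {rootTree}
  | n + 1 => open Classical in (reachable n).biUnion children

theorem IsBSTChain.ae_mem_reachable [IsProbabilityMeasure P] (hX : IsBSTChain P X) (n : ℕ) :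
    ∀ᵐ ω ∂P, X (n + 1) ω ∈ reachable n := by
  classical
  induction n with
  | zero =>
    filter_upwards [hX.start] with ω hω
    simp [reachable, hω]
  | succ n ih =>
    filter_upwards [ih, hX.ae_mem_children (n := n + 1) (by omega)] with ω h1 h2
    exact Finset.mem_biUnion.2 ⟨_, h1, h2⟩

theorem card_of_mem_reachable {n : ℕ} {x : BinTree} (h : x ∈ reachable n) :
    x.nodes.card = n + 1 := by
  classical
  induction n generalizing x with
  | zero =>
    rw [reachable, Finset.mem_singleton] at h
    simp [h, rootTree]
  | succ n ih =>
    obtain ⟨y, hy, hx⟩ := Finset.mem_biUnion.1 h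
    obtain ⟨w, hw, rfl⟩ := mem_children.1 hx
    rw [card_addNode hw, ih hy]

theorem IsBSTChain.ae_card [IsProbabilityMeasure P] (hX : IsBSTChain P X) :
    ∀ᵐ ω ∂P, ∀ n, (X (n + 1) ω).nodes.card = n + 1 := by
  filter_upwards [ae_all_iff.2 hX.ae_mem_reachable] with ω hω n
  exact card_of_mem_reachable (hω n)

/-- At each fixed time the chain lives almost surely on a finite set of trees, so every function of
it is bounded. -/
theorem IsBSTChain.integrable [IsProbabilityMeasure P] (hX : IsBSTChain P X) (g : BinTree → ℝ)
    (n : ℕ) : Integrable (fun ω => g (X (n + 1) ω)) P := by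
  refine Integrable.of_bound (C := ∑ x ∈ reachable n, |g x|)
    (measurable_from_top.comp (hX.measurable (n + 1) (by omega))).aestronglyMeasurable ?_
  filter_upwards [hX.ae_mem_reachable n] with ω hω
  exact Finset.single_le_sum (f := fun x => |g x|) (fun _ _ => abs_nonneg _) hω

theorem IsBSTChain.setIntegral_succ [IsProbabilityMeasure P] (hX : IsBSTChain P X)
    (g : BinTree → ℝ) (n : ℕ) {A : Set Ω} (hA : MeasurableSet[natSigma X (n + 1)] A) :
    ∫ ω in A, g (X (n + 2) ω) ∂P = ∫ ω in A, stepMean g (X (n + 1) ω) ∂P := by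
  obtain ⟨S, rfl⟩ := exists_preimage_path hA
  have hS : path X (n + 1) ⁻¹' S = ⋃ s : S, path X (n + 1) ⁻¹' {s.1} := by
    ext ω; simp
  rw [hS]
  have hm : ∀ s : S, MeasurableSet (path X (n + 1) ⁻¹' {s.1}) := fun s =>
    hX.measurable_path _ (measurableSet_singleton _)
  have hd : Pairwise (Function.onFun Disjoint fun s : S => path X (n + 1) ⁻¹' {s.1}) := by
    intro s t hst
    refine Disjoint.preimage _ ?_
    simpa using fun h => hst (Subtype.ext h)
  refine (hasSum_integral_iUnion hm hd (hX.integrable g (n + 1)).integrableOn).unique ?_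
  simp only [hX.integral_path (n := n + 1) (by omega)]
  exact hasSum_integral_iUnion hm hd (hX.integrable (stepMean g) n).integrableOn

/-- The natural filtration of the chain, started at time 1. -/
def chainFiltration (hX : IsBSTChain P X) : Filtration ℕ mΩ where
  seq n := natSigma X (n + 1)
  mono' m n h := biSup_mono (fun i hi => by
    have h : m ≤ n := h
    rw [Finset.mem_Icc] at hi ⊢; omega)
  le' n := natSigma_le hX (n + 1)

theorem IsBSTChain.stronglyMeasurable (hX : IsBSTChain P X) (g : BinTree → ℝ) (n : ℕ) :
    StronglyMeasurable[chainFiltration hX n] (fun ω => g (X (n + 1) ω)) := by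
  have h : Measurable[chainFiltration hX n] (X (n + 1)) := by
    rw [measurable_iff_comap_le]
    exact le_iSup₂ (f := fun i (_ : i ∈ Finset.Icc 1 (n + 1)) =>
      MeasurableSpace.comap (X i) inferInstance) (n + 1) (by simp)
  exact ((measurable_from_top (f := g)).comp h).stronglyMeasurable

theorem IsBSTChain.martingale [IsProbabilityMeasure P] (hX : IsBSTChain P X) {g : BinTree → ℝ}
    (hg : ∀ x, ∑ w ∈ externalNodes x, (g (addNode x w) - g x) = 0) :
    Martingale (fun n ω => g (X (n + 1) ω)) (chainFiltration hX) P := by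
  refine martingale_of_setIntegral_eq_succ (hX.stronglyMeasurable g) (hX.integrable g)
    (fun n A hA => ?_)
  rw [hX.setIntegral_succ g n hA]
  simp only [stepMean_eq_self (hg _)]

theorem IsBSTChain.integral_le_of_superharmonic [IsProbabilityMeasure P] (hX : IsBSTChain P X)
    {g : BinTree → ℝ}
    (hg : ∀ x, ∑ w ∈ externalNodes x, g (addNode x w) ≤ ((x.nodes.card : ℝ) + 1) * g x) (n : ℕ) :
    ∫ ω, g (X (n + 1) ω) ∂P ≤ g rootTree := by
  induction n with
  | zero =>
    have : (fun ω => g (X (0 + 1) ω)) =ᵐ[P] fun _ => g rootTree := by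
      filter_upwards [hX.start] with ω hω
      rw [zero_add, hω]
    rw [integral_congr_ae this]
    simp
  | succ n ih =>
    refine le_trans ?_ ih
    have h := hX.setIntegral_succ g n (A := Set.univ) MeasurableSet.univ
    rw [setIntegral_univ, setIntegral_univ] at h
    change ∫ ω, g (X (n + 2) ω) ∂P ≤ _
    rw [h]
    refine integral_mono (hX.integrable (stepMean g) n) (hX.integrable g n) (fun ω => ?_)
    rw [stepMean, inv_mul_le_iff₀ (by positivity)]
    exact hg _

/-- The compensated square starts at `-levelMass k rootTree ≤ 0` and its mean stays below that
value. -/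
theorem IsBSTChain.integral_levelDev_sq_le [IsProbabilityMeasure P] (hX : IsBSTChain P X)
    (k n : ℕ) : ∫ ω, levelDev k (X (n + 1) ω) ^ 2 ∂P ≤ 2 * 2⁻¹ ^ k := by
  have h := hX.integral_le_of_superharmonic (g := fun x => levelDev k x ^ 2 - levelMass k x)
    (sum_levelDev_sq_sub_levelMass_le k) n
  rw [integral_sub (hX.integrable (fun x => levelDev k x ^ 2) n) (hX.integrable (levelMass k) n),
    levelDev_rootTree] at h
  have h1 : ∫ ω, levelMass k (X (n + 1) ω) ∂P ≤ 2 * 2⁻¹ ^ k := by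
    refine (integral_mono (hX.integrable (levelMass k) n)
      (integrable_const _) (fun ω => levelMass_le k _)).trans (by simp)
  have h2 := levelMass_nonneg k rootTree
  linarith

theorem IsBSTChain.lintegral_levelDev_sq_le [IsProbabilityMeasure P] (hX : IsBSTChain P X)
    (k n : ℕ) : ∫⁻ ω, ‖levelDev k (X (n + 1) ω)‖ₑ ^ (2 : ℝ) ∂P ≤
      ENNReal.ofReal (2 * 2⁻¹ ^ k) := by
  have h : ∀ ω, ‖levelDev k (X (n + 1) ω)‖ₑ ^ (2 : ℝ) =
      ENNReal.ofReal (levelDev k (X (n + 1) ω) ^ 2) := by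
    intro ω
    rw [← ofReal_norm, ENNReal.ofReal_rpow_of_nonneg (norm_nonneg _) (by norm_num)]
    simp
  simp only [h]
  rw [← ofReal_integral_eq_lintegral_ofReal (hX.integrable (fun x => levelDev k x ^ 2) n)
    (ae_of_all _ (fun ω => sq_nonneg _))]
  exact ENNReal.ofReal_le_ofReal (hX.integral_levelDev_sq_le k n)

theorem IsBSTChain.eLpNorm_levelDev_le [IsProbabilityMeasure P] (hX : IsBSTChain P X) (k n : ℕ) :
    eLpNorm (fun ω => levelDev k (X (n + 1) ω)) 2 P ≤
      ENNReal.ofReal (2 * 2⁻¹ ^ k) ^ (1 / 2 : ℝ) := by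
  rw [eLpNorm_eq_lintegral_rpow_enorm_toReal (by simp) (by simp)]
  exact ENNReal.rpow_le_rpow (hX.lintegral_levelDev_sq_le k n) (by norm_num)

/-! ### Consequences of moment bounds: uniform integrability and almost sure limits. -/

theorem uniformIntegrable_of_lintegral_sq_le {ι : Type*} {f : ι → Ω → ℝ} [IsFiniteMeasure P]
    (hf : ∀ i, AEStronglyMeasurable (f i) P) {K : ENNReal} (hK : K ≠ ⊤)
    (h : ∀ i, ∫⁻ ω, ‖f i ω‖ₑ ^ (2 : ℝ) ∂P ≤ K) : UniformIntegrable f 1 P := by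
  refine uniformIntegrable_of le_rfl (by simp) hf (fun ε hε => ?_)
  -- On `|f| ≥ c` one has `|f| ≤ f² / c`, so `K / c ≤ ε` suffices; the `+ 1` keeps `c` nonzero.
  set c : NNReal := (K.toReal / ε).toNNReal + 1 with hc
  have hc0 : (c : ENNReal) ≠ 0 := by simp [hc]
  refine ⟨c, fun i => ?_⟩
  rw [eLpNorm_one_eq_lintegral_enorm]
  calc ∫⁻ ω, ‖{x | c ≤ ‖f i x‖₊}.indicator (f i) ω‖ₑ ∂P
      ≤ ∫⁻ ω, (c : ENNReal)⁻¹ * ‖f i ω‖ₑ ^ (2 : ℝ) ∂P := by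
        refine lintegral_mono (fun ω => ?_)
        by_cases hω : c ≤ ‖f i ω‖₊
        · rw [Set.indicator_of_mem (by exact hω), ENNReal.rpow_two, sq, ← mul_assoc]
          refine le_mul_of_one_le_left zero_le ?_
          rw [mul_comm, ← div_eq_mul_inv, ENNReal.le_div_iff_mul_le (Or.inl hc0) (by simp), one_mul]
          exact ENNReal.coe_le_coe.2 hω
        · rw [Set.indicator_of_notMem (by exact hω)]
          simp
    _ ≤ (c : ENNReal)⁻¹ * K := by
        rw [lintegral_const_mul' _ _ (ENNReal.inv_ne_top.2 hc0)]
        gcongr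
        exact h i
    _ ≤ ENNReal.ofReal ε := by
        rw [mul_comm, ← div_eq_mul_inv, ENNReal.div_le_iff hc0 (by simp),
          ← ENNReal.ofReal_toReal hK, ← ENNReal.ofReal_coe_nnreal, ← ENNReal.ofReal_mul hε.le]
        refine ENNReal.ofReal_le_ofReal ?_
        rw [hc, NNReal.coe_add, Real.coe_toNNReal _ (by positivity), NNReal.coe_one, mul_add,
          mul_div_cancel₀ _ hε.ne']
        linarith

/-- Summable second moments force almost sure convergence to zero. -/
theorem ae_tendsto_zero_of_lintegral_sq_le {f : ℕ → Ω → ℝ}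
    (hf : ∀ k, AEStronglyMeasurable (f k) P) {K : ℕ → ENNReal} (hK : ∑' k, K k ≠ ⊤)
    (h : ∀ k, ∫⁻ ω, ‖f k ω‖ₑ ^ (2 : ℝ) ∂P ≤ K k) :
    ∀ᵐ ω ∂P, Tendsto (fun k => f k ω) atTop (𝓝 0) := by
  have hm : ∀ k, AEMeasurable (fun ω => ‖f k ω‖ₑ ^ (2 : ℝ)) P := fun k =>
    (hf k).enorm.pow_const _
  have h1 : ∫⁻ ω, ∑' k, ‖f k ω‖ₑ ^ (2 : ℝ) ∂P ≠ ⊤ := by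
    rw [lintegral_tsum hm]
    exact ne_top_of_le_ne_top hK (ENNReal.tsum_le_tsum h)
  filter_upwards [ae_lt_top' (AEMeasurable.tsum hm) h1] with ω hω
  have h2 := ENNReal.tendsto_atTop_zero_of_tsum_ne_top hω.ne
  have h3 := (ENNReal.continuous_rpow_const (y := (1 / 2 : ℝ))).continuousAt.tendsto.comp h2
  rw [ENNReal.zero_rpow_of_pos (by norm_num)] at h3
  have h4 : Tendsto (fun k => ‖f k ω‖ₑ) atTop (𝓝 0) := by
    refine h3.congr (fun k => ?_)
    simp only [Function.comp]
    rw [← ENNReal.rpow_mul]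
    norm_num
  exact tendsto_zero_iff_enorm_tendsto_zero.2 h4

/-- Fatou's lemma: a uniform norm bound passes to an almost sure limit. -/
theorem eLpNorm_le_of_ae_tendsto {f : ℕ → Ω → ℝ} {g : Ω → ℝ} {p R : ENNReal}
    (hf : ∀ n, AEStronglyMeasurable (f n) P) (hR : ∀ n, eLpNorm (f n) p P ≤ R)
    (h : ∀ᵐ ω ∂P, Tendsto (fun n => f n ω) atTop (𝓝 (g ω))) : eLpNorm g p P ≤ R := by
  refine (Lp.eLpNorm_lim_le_liminf_eLpNorm hf g h).trans
    (liminf_le_of_le (by isBoundedDefault) (fun b hb => ?_))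
  obtain ⟨n, hn⟩ := hb.exists
  exact hn.trans (hR n)

theorem Martingale.ae_tendsto_of_nonneg {f : ℕ → Ω → ℝ} {ℱ : Filtration ℕ mΩ}
    [IsProbabilityMeasure P] (hf : Martingale f ℱ P) (h0 : ∀ n ω, 0 ≤ f n ω) :
    ∀ᵐ ω ∂P, ∃ c, Tendsto (fun n => f n ω) atTop (𝓝 c) := by
  refine hf.submartingale.exists_ae_tendsto_of_bdd (R := (∫ ω, f 0 ω ∂P).toNNReal) (fun n => ?_)
  rw [eLpNorm_one_eq_lintegral_enorm]
  have h : ∀ ω, ‖f n ω‖ₑ = ENNReal.ofReal (f n ω) := fun ω => Real.enorm_of_nonneg (h0 n ω)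
  simp only [h]
  rw [← ofReal_integral_eq_lintegral_ofReal (hf.integrable n) (ae_of_all _ (h0 n))]
  have h1 := hf.setIntegral_eq (Nat.zero_le n) MeasurableSet.univ
  rw [setIntegral_univ, setIntegral_univ] at h1
  rw [h1]
  rfl

end Chain

/-! ### Limits of urn sequences -/

theorem harmonic_mono {m n : ℕ} (h : m ≤ n) : (harmonic m : ℝ) ≤ harmonic n := by
  induction n, h using Nat.le_induction with
  | base => exact le_rfl
  | succ n _ ih =>
    rw [harmonic_succ]
    push_cast
    have : (0 : ℝ) ≤ ((n : ℝ) + 1)⁻¹ := by positivity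
    linarith

theorem urnLog_le_one (a b : ℕ) : urnLog a b ≤ 1 := by
  have h1 : (harmonic a : ℝ) ≤ harmonic (a + b + 1) := harmonic_mono (by omega)
  have h2 : (harmonic b : ℝ) ≤ harmonic (a + b + 1) := harmonic_mono (by omega)
  unfold urnLog
  linarith

theorem urnLog_comm (a b : ℕ) : urnLog a b = urnLog b a := by
  unfold urnLog
  rw [add_comm b a, add_comm (harmonic b : ℝ)]

/-- If `urnLog` stays bounded below then neither share can degenerate. -/
theorem pos_of_tendsto_share {a b : ℕ → ℕ} {c l : ℝ}
    (hs : Tendsto (fun n => a n + b n + 1) atTop atTop)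
    (hlog : Tendsto (fun n => urnLog (a n) (b n)) atTop (𝓝 l))
    (hc : Tendsto (fun n => (a n : ℝ) / (a n + b n + 1 : ℕ)) atTop (𝓝 c)) : 0 < c := by
  -- Combining `urnLog > l - 1` with `H(b) ≤ H(s)`, `H(a) ≤ 1 + log a` and `log (s + 1) ≤ H(s)`
  -- gives `log (s + 1) - M ≤ log a`, so the share is at least `exp (-M)`.
  set M : ℝ := 3 - 2 * (l - 1) with hM
  have hs' : Tendsto (fun n => Real.log (((a n + b n + 1 : ℕ) : ℝ) + 1)) atTop atTop :=
    Real.tendsto_log_atTop.comp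
      (tendsto_atTop_add_const_right _ _ (tendsto_natCast_atTop_atTop.comp hs))
  refine (Real.exp_pos (-M)).trans_le (ge_of_tendsto hc ?_)
  filter_upwards [hlog.eventually (lt_mem_nhds (show l - 1 < l by linarith)),
    hs'.eventually_gt_atTop M] with n h1 h2
  set s := a n + b n + 1 with hsdef
  have hspos : (0 : ℝ) < s := by rw [hsdef]; positivity
  have h3 : (harmonic (b n) : ℝ) ≤ harmonic s := harmonic_mono (by omega)
  have h4 := harmonic_le_one_add_log (a n)
  have h5 := log_add_one_le_harmonic s
  push_cast at h5
  unfold urnLog at h1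
  rw [← hsdef] at h1
  have h6 : Real.log ((s : ℝ) + 1) - M ≤ Real.log (a n) := by linarith
  -- As `log 0 = 0` by convention, `a n = 0` must be excluded separately, using `log (s + 1) > M`.
  have h7 : a n ≠ 0 := by
    intro h0
    rw [h0, Nat.cast_zero, Real.log_zero] at h6
    linarith
  have h8 : (0 : ℝ) < a n := by positivity
  rw [le_div_iff₀ hspos]
  have h9 : Real.exp (-M) * (s + 1) ≤ a n := by
    rw [← Real.exp_log h8, ← Real.exp_log (show (0 : ℝ) < s + 1 by positivity), ← Real.exp_add]
    exact Real.exp_le_exp.2 (by linarith)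
  nlinarith [Real.exp_pos (-M)]

theorem tendsto_compl_share {a b : ℕ → ℕ} {c : ℝ}
    (hs : Tendsto (fun n => a n + b n + 1) atTop atTop)
    (hc : Tendsto (fun n => (a n : ℝ) / (a n + b n + 1 : ℕ)) atTop (𝓝 c)) :
    Tendsto (fun n => (b n : ℝ) / (a n + b n + 1 : ℕ)) atTop (𝓝 (1 - c)) := by
  have h1 : Tendsto (fun n => (((a n + b n + 1 : ℕ) : ℝ))⁻¹) atTop (𝓝 0) :=
    tendsto_inv_atTop_zero.comp (tendsto_natCast_atTop_atTop.comp hs)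
  have h2 := (tendsto_const_nhds (x := (1 : ℝ))).sub (hc.add h1)
  rw [add_zero] at h2
  refine h2.congr (fun n => ?_)
  have : (((a n + b n + 1 : ℕ) : ℝ)) ≠ 0 := by positivity
  push_cast at this ⊢
  field_simp
  ring

theorem exists_tendsto_share {a b : ℕ → ℕ} {c l : ℝ}
    (hs : Tendsto (fun n => a n + b n + 1) atTop atTop)
    (hc : Tendsto (fun n => urnShare (a n) (b n)) atTop (𝓝 c))
    (hlog : Tendsto (fun n => urnLog (a n) (b n)) atTop (𝓝 l)) :
    ∃ c', 0 < c' ∧ c' < 1 ∧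
      Tendsto (fun n => (a n : ℝ) / (a n + b n + 1 : ℕ)) atTop (𝓝 c') := by
  have h1 : Tendsto (fun n => (((a n + b n + 1 : ℕ) : ℝ))⁻¹) atTop (𝓝 0) :=
    tendsto_inv_atTop_zero.comp (tendsto_natCast_atTop_atTop.comp hs)
  have h2 : Tendsto (fun n => (a n : ℝ) / (a n + b n + 1 : ℕ)) atTop (𝓝 c) := by
    -- With `s = a + b + 1`, `a / s = urnShare a b * (1 + 1 / s) - 1 / s`: counting internal or
    -- external nodes makes no difference in the limit.
    have h3 := (hc.mul ((tendsto_const_nhds (x := (1 : ℝ))).add h1)).sub h1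
    rw [add_zero, mul_one, sub_zero] at h3
    refine h3.congr (fun n => ?_)
    have h4 : ((a n : ℝ) + b n + 1) ≠ 0 := by positivity
    have h5 : ((a n : ℝ) + b n + 2) ≠ 0 := by positivity
    unfold urnShare
    push_cast
    field_simp
    ring
  refine ⟨c, pos_of_tendsto_share hs hlog h2, ?_, h2⟩
  have e : ∀ n, a n + b n + 1 = b n + a n + 1 := fun n => by ring
  have h6 := tendsto_compl_share hs h2
  simp only [e] at hs h6
  have := pos_of_tendsto_share hs (hlog.congr (fun n => urnLog_comm _ _)) h6
  linarith

/-- Both sizes tend to infinity, so each harmonic number is a logarithm plus `γ + o(1)`; the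
constants cancel as `(γ + γ) / 2 - γ`. -/
theorem tendsto_urnLog {a b : ℕ → ℕ} {c : ℝ} (h0 : 0 < c) (h1 : c < 1)
    (hs : Tendsto (fun n => a n + b n + 1) atTop atTop)
    (hc : Tendsto (fun n => (a n : ℝ) / (a n + b n + 1 : ℕ)) atTop (𝓝 c)) :
    Tendsto (fun n => urnLog (a n) (b n)) atTop (𝓝 (C c)) := by
  have hd := tendsto_compl_share hs hc
  have hsR : Tendsto (fun n => ((a n + b n + 1 : ℕ) : ℝ)) atTop atTop :=
    tendsto_natCast_atTop_atTop.comp hs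
  have key : ∀ (f : ℕ → ℕ) (d : ℝ), 0 < d →
      Tendsto (fun n => (f n : ℝ) / (a n + b n + 1 : ℕ)) atTop (𝓝 d) → Tendsto f atTop atTop := by
    intro f d hd0 hd
    refine tendsto_natCast_atTop_iff.1 ((hd.pos_mul_atTop hd0 hsR).congr (fun n => ?_))
    have : (((a n + b n + 1 : ℕ) : ℝ)) ≠ 0 := by positivity
    field_simp
  have ha := key a c h0 hc
  have hb := key b (1 - c) (by linarith) hd
  have hγ := Real.tendsto_harmonic_sub_log
  have h2 := (((hγ.comp ha).add (hγ.comp hb)).mul_const (1 / 2)).sub (hγ.comp hs)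
  have h3 := (((hc.log h0.ne').add (hd.log (by linarith))).const_mul (1 / 2)).const_add 1
  have h4 := h3.add h2
  have e : 1 + 1 / 2 * (Real.log c + Real.log (1 - c)) +
      ((Real.eulerMascheroniConstant + Real.eulerMascheroniConstant) * (1 / 2) -
        Real.eulerMascheroniConstant) = C c := by
    unfold C; ring
  rw [e] at h4
  refine h4.congr' ?_
  filter_upwards [ha.eventually_gt_atTop 0, hb.eventually_gt_atTop 0] with n h5 h6
  simp only [Function.comp]
  have h7 : (((a n + b n + 1 : ℕ) : ℝ)) ≠ 0 := by positivity
  rw [Real.log_div (by positivity) h7, Real.log_div (by positivity) h7]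
  unfold urnLog
  ring

/-! ### Limits of sequences of trees -/

/-- Every urn along the sequence of trees converges. -/
structure UrnsConverge (x : ℕ → BinTree) : Prop where
  card : ∀ n, (x n).nodes.card = n + 1
  share : ∀ u : Node, ∃ c, Tendsto (fun n =>
    urnShare (subtreeSize (x n) (u ++ [false])) (subtreeSize (x n) (u ++ [true]))) atTop (𝓝 c)
  log : ∀ u : Node, ∃ c, Tendsto (fun n =>
    urnLog (subtreeSize (x n) (u ++ [false])) (subtreeSize (x n) (u ++ [true]))) atTop (𝓝 c)

theorem UrnsConverge.tendsto_card {x : ℕ → BinTree} (hx : UrnsConverge x) :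
    Tendsto (fun n => (x n).nodes.card) atTop atTop := by
  simp only [hx.card]
  exact tendsto_add_atTop_nat 1

theorem tendsto_subtreeSize_atTop {x : ℕ → BinTree} {u : Node} {m : ℝ} (hm : 0 < m)
    (hcard : Tendsto (fun n => (x n).nodes.card) atTop atTop)
    (h : Tendsto (fun n => (subtreeSize (x n) u : ℝ) / (x n).nodes.card) atTop (𝓝 m)) :
    Tendsto (fun n => subtreeSize (x n) u) atTop atTop := by
  refine tendsto_natCast_atTop_iff.1
    ((h.pos_mul_atTop hm (tendsto_natCast_atTop_atTop.comp hcard)).congr (fun n => ?_))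
  have : ((x n).nodes.card : ℝ) ≠ 0 := by
    have := (x n).nonempty.card_pos
    positivity
  simp only [Function.comp]
  field_simp

theorem eventually_subtreeSize_split {x : ℕ → BinTree} {u : Node}
    (h : Tendsto (fun n => subtreeSize (x n) u) atTop atTop) :
    (fun n => subtreeSize (x n) u) =ᶠ[atTop]
      fun n => subtreeSize (x n) (u ++ [false]) + subtreeSize (x n) (u ++ [true]) + 1 := by
  filter_upwards [h.eventually_gt_atTop 0] with n hn
  by_contra hne
  refine hne (subtreeSize_split ?_)
  by_contra hu
  exact hn.ne' (subtreeSize_eq_zero hu)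

/-- The relative size of a subtree is a product of shares along the path from the root, each with a
positive limit. Positivity at `u` is also what makes the urn at `u` grow, so it is carried through
the induction. -/
theorem UrnsConverge.exists_tendsto {x : ℕ → BinTree} (hx : UrnsConverge x) (u : Node) :
    ∃ m, 0 < m ∧
      Tendsto (fun n => (subtreeSize (x n) u : ℝ) / (x n).nodes.card) atTop (𝓝 m) := by
  induction u using List.reverseRecOn with
  | nil =>
    refine ⟨1, one_pos, tendsto_const_nhds.congr (fun n => ?_)⟩
    rw [subtreeSize_nil, div_self]
    have := (x n).nonempty.card_pos
    positivity
  | append_singleton u b ih =>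
    obtain ⟨m, hm, hmt⟩ := ih
    have hs := tendsto_subtreeSize_atTop hm hx.tendsto_card hmt
    have hev := eventually_subtreeSize_split hs
    have hs' := hs.congr' hev
    obtain ⟨c, hc⟩ := hx.share u
    obtain ⟨l, hl⟩ := hx.log u
    obtain ⟨c', h0, h1, hc'⟩ := exists_tendsto_share hs' hc hl
    have key : ∃ d, 0 < d ∧ Tendsto (fun n => (subtreeSize (x n) (u ++ [b]) : ℝ) /
        (subtreeSize (x n) (u ++ [false]) + subtreeSize (x n) (u ++ [true]) + 1 : ℕ))
          atTop (𝓝 d) := by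
      cases b
      · exact ⟨c', h0, hc'⟩
      · exact ⟨1 - c', by linarith, tendsto_compl_share hs' hc'⟩
    obtain ⟨d, hd0, hd⟩ := key
    refine ⟨d * m, mul_pos hd0 hm, (hd.mul hmt).congr' ?_⟩
    filter_upwards [hev] with n hn
    rw [hn, div_mul_div_cancel₀ (by positivity)]

theorem UrnsConverge.pos_of_doobMartinTendsto {x : ℕ → BinTree} (hx : UrnsConverge x)
    {μ : ProbabilityMeasure Ends} (hμ : DoobMartinTendsto x μ) (u : Node) :
    0 < (μ : Measure Ends).real (cyl u) := by
  obtain ⟨m, hm, h⟩ := hx.exists_tendsto u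
  rwa [tendsto_nhds_unique (hμ.2 u) h]

theorem UrnsConverge.tendsto_urnLog {x : ℕ → BinTree} (hx : UrnsConverge x)
    {μ : ProbabilityMeasure Ends} (hμ : DoobMartinTendsto x μ) (u : Node) :
    Tendsto (fun n => urnLog (subtreeSize (x n) (u ++ [false])) (subtreeSize (x n) (u ++ [true])))
      atTop (𝓝 (C (xi μ u))) := by
  have hm := hx.pos_of_doobMartinTendsto hμ
  have hs := tendsto_subtreeSize_atTop (hm u) hμ.1 (hμ.2 u)
  have hev := eventually_subtreeSize_split hs
  have key : ∀ b : Bool, Tendsto (fun n => (subtreeSize (x n) (u ++ [b]) : ℝ) /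
      (subtreeSize (x n) (u ++ [false]) + subtreeSize (x n) (u ++ [true]) + 1 : ℕ)) atTop
      (𝓝 ((μ : Measure Ends).real (cyl (u ++ [b])) / (μ : Measure Ends).real (cyl u))) := by
    intro b
    refine ((hμ.2 (u ++ [b])).div (hμ.2 u) (hm u).ne').congr' ?_
    filter_upwards [hev] with n hn
    rw [Pi.div_apply, hn]
    have := (x n).nonempty.card_pos
    have : ((x n).nodes.card : ℝ) ≠ 0 := by positivity
    exact div_div_div_cancel_right₀ this _ _
  have hc := key false
  have hd := tendsto_nhds_unique (key true) (tendsto_compl_share (hs.congr' hev) hc)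
  have h1 := div_pos (hm (u ++ [true])) (hm u)
  rw [hd] at h1
  exact BST.tendsto_urnLog (div_pos (hm (u ++ [false])) (hm u)) (sub_pos.1 h1) (hs.congr' hev) hc

theorem UrnsConverge.tendsto_levelDev_sub {x : ℕ → BinTree} (hx : UrnsConverge x)
    {μ : ProbabilityMeasure Ends} (hμ : DoobMartinTendsto x μ) (k : ℕ) :
    Tendsto (fun n => levelDev 0 (x n) - levelDev k (x n)) atTop (𝓝 (partialL μ k)) := by
  simp only [levelDev_zero_sub]
  exact tendsto_finsetSum _ (fun j _ => tendsto_finsetSum _ (fun u _ =>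
    (hx.tendsto_urnLog hμ _).const_mul _))

/-! ### Measures on the set of ends -/

theorem cyl_inter_cyl_eq_right {u v : Node} {w : Ends} (hu : w ∈ cyl u) (hv : w ∈ cyl v)
    (h : u.length ≤ v.length) : cyl u ∩ cyl v = cyl v := by
  refine Set.inter_eq_right.2 (fun z hz => ?_)
  have h1 : u <+: v := by
    have := endPrefix_prefix w h
    rwa [hu, hv] at this
  have h2 : endPrefix z u.length <+: v := by
    have := endPrefix_prefix z h
    rwa [hz] at this
  exact eq_of_prefix_of_length_eq h2 h1 (endPrefix_length _ _)

/-- Two cylinders with a common point are nested. -/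
theorem isPiSystem_cyl : IsPiSystem (Set.range cyl) := by
  rintro _ ⟨u, rfl⟩ _ ⟨v, rfl⟩ ⟨w, hu, hv⟩
  rcases le_total u.length v.length with h | h
  · exact ⟨v, (cyl_inter_cyl_eq_right hu hv h).symm⟩
  · exact ⟨u, by rw [Set.inter_comm, cyl_inter_cyl_eq_right hv hu h]⟩

theorem generateFrom_cyl :
    (inferInstance : MeasurableSpace Ends) = MeasurableSpace.generateFrom (Set.range cyl) := by
  refine le_antisymm ?_ ?_
  · refine iSup_le (fun i => ?_)
    rintro _ ⟨T, _, rfl⟩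
    have h : (fun v : Ends => v i) ⁻¹' T =
        ⋃ u ∈ {u : Node | u.length = i + 1 ∧ u.getD i false ∈ T}, cyl u := by
      ext v
      have hget : (endPrefix v (i + 1)).getD i false = v i := by
        rw [List.getD_eq_getElem _ _ (by simp [endPrefix])]
        exact List.getElem_ofFn _
      simp only [Set.mem_preimage, Set.mem_iUnion, Set.mem_ofPred_eq, exists_prop]
      constructor
      · intro hv
        refine ⟨endPrefix v (i + 1), ⟨endPrefix_length _ _, by rwa [hget]⟩, ?_⟩
        change endPrefix v _ = _
        rw [endPrefix_length]
      · rintro ⟨u, ⟨hu, huT⟩, hv⟩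
        change endPrefix v _ = _ at hv
        rw [hu] at hv
        rwa [← hv, hget] at huT
    change MeasurableSet[MeasurableSpace.generateFrom (Set.range cyl)] ((fun v : Ends => v i) ⁻¹' T)
    rw [h]
    exact @MeasurableSet.biUnion _ _ (MeasurableSpace.generateFrom (Set.range cyl)) _ _ (Set.to_countable _)
      (fun u _ => MeasurableSpace.measurableSet_generateFrom ⟨u, rfl⟩)
  · refine MeasurableSpace.generateFrom_le ?_
    rintro _ ⟨u, rfl⟩
    exact measurableSet_cyl u

theorem measurable_of_measurable_cyl {Ω : Type*} [MeasurableSpace Ω]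
    {μ : Ω → ProbabilityMeasure Ends}
    (h : ∀ u, Measurable (fun ω => (μ ω : Measure Ends).real (cyl u))) : Measurable μ := by
  refine Measurable.subtype_mk (f := fun ω => (μ ω : Measure Ends)) ?_
  refine Measurable.measure_of_isPiSystem_of_isProbabilityMeasure generateFrom_cyl
    isPiSystem_cyl ?_
  rintro _ ⟨u, rfl⟩
  have h1 := (h u).ennreal_ofReal
  have h2 : ∀ ω, ENNReal.ofReal ((μ ω : Measure Ends).real (cyl u)) = (μ ω : Measure Ends) (cyl u) :=
    fun ω => ENNReal.ofReal_toReal (measure_ne_top _ _)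
  simpa only [h2] using h1

/-- The end that continues the word `v` with zeros. -/
def extend (v : Node) : Ends := fun i => v.getD i false

theorem extend_mem_cyl {u v : Node} (h : u <+: v) : extend v ∈ cyl u := by
  obtain ⟨t, rfl⟩ := h
  change endPrefix _ _ = _
  refine List.ext_getElem (endPrefix_length _ _) (fun i h1 h2 => ?_)
  simp [endPrefix, extend, List.getD, List.getElem?_append_left h2, h2]

theorem prefix_or_prefix_of_extend_mem_cyl {u v : Node} (h : extend v ∈ cyl u) :
    u <+: v ∨ v <+: u := by
  have h1 : endPrefix (extend v) v.length = v := extend_mem_cyl List.prefix_rfl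
  have h2 : endPrefix (extend v) u.length = u := h
  rcases le_total u.length v.length with hl | hl
  · left
    have := endPrefix_prefix (extend v) hl
    rwa [h1, h2] at this
  · right
    have := endPrefix_prefix (extend v) hl
    rwa [h1, h2] at this

/-- The uniform distribution on the nodes of `x`, continued with zeros. -/
def nodeMeasure (x : BinTree) : ProbabilityMeasure Ends :=
  ⟨((PMF.uniformOfFinset x.nodes x.nonempty).map extend).toMeasure, inferInstance⟩

theorem nodeMeasure_real_cyl (x : BinTree) (u : Node) :
    (nodeMeasure x : Measure Ends).real (cyl u) =
      ((open Classical in x.nodes.filter (fun v => extend v ∈ cyl u)).card : ℝ) / x.nodes.card := by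
  classical
  change (((PMF.uniformOfFinset x.nodes x.nonempty).map extend).toMeasure).real (cyl u) = _
  rw [measureReal_def, PMF.toMeasure_apply_eq_toOuterMeasure_apply _ (measurableSet_cyl u),
    PMF.toOuterMeasure_map_apply, PMF.toOuterMeasure_uniformOfFinset_apply]
  simp [ENNReal.toReal_div]

/-- The nodes that enter `cyl u` only through their continuation by zeros are prefixes of `u`, at
most `|u| + 1` of them. -/
theorem abs_nodeMeasure_sub_le (x : BinTree) (u : Node) :
    |(nodeMeasure x : Measure Ends).real (cyl u) - (subtreeSize x u : ℝ) / x.nodes.card| ≤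
      ((u.length : ℝ) + 1) / x.nodes.card := by
  classical
  rw [nodeMeasure_real_cyl, ← sub_div, abs_div, Nat.abs_cast]
  refine div_le_div_of_nonneg_right ?_ (Nat.cast_nonneg _)
  have h1 : x.nodes.filter (fun w => u <+: w) ⊆ x.nodes.filter (fun v => extend v ∈ cyl u) :=
    Finset.monotone_filter_right _ (fun v _ h => extend_mem_cyl h)
  have h2 : x.nodes.filter (fun v => extend v ∈ cyl u) ⊆
      x.nodes.filter (fun w => u <+: w) ∪ u.inits.toFinset := by
    intro v hv
    obtain ⟨hv, h⟩ := Finset.mem_filter.1 hv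
    rw [Finset.mem_union, Finset.mem_filter, List.mem_toFinset, List.mem_inits]
    exact (prefix_or_prefix_of_extend_mem_cyl h).imp (fun h => ⟨hv, h⟩) id
  have h3 : (subtreeSize x u : ℝ) ≤ (x.nodes.filter (fun v => extend v ∈ cyl u)).card := by
    exact_mod_cast Finset.card_le_card h1
  have h4 : ((x.nodes.filter (fun v => extend v ∈ cyl u)).card : ℝ) ≤
      subtreeSize x u + (u.length + 1) := by
    have h5 : u.inits.toFinset.card ≤ u.length + 1 := by
      simpa using List.toFinset_card_le u.inits
    have := (Finset.card_le_card h2).trans ((Finset.card_union_le _ _).trans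
      (Nat.add_le_add_left h5 _))
    exact_mod_cast this
  rw [abs_le]
  constructor <;> linarith [Nat.cast_nonneg (α := ℝ) u.length]

/-- Convergence of all relative subtree sizes is convergence in the Doob-Martin
compactification. -/
theorem exists_doobMartinTendsto {x : ℕ → BinTree}
    (hcard : Tendsto (fun n => (x n).nodes.card) atTop atTop) {m : Node → ℝ}
    (hm : ∀ u, Tendsto (fun n => (subtreeSize (x n) u : ℝ) / (x n).nodes.card) atTop
      (𝓝 (m u))) : ∃ μ : ProbabilityMeasure Ends, DoobMartinTendsto x μ := by
  -- Compactness gives a limit along an ultrafilter. Cylinders are clopen, so its cylinder masses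
  -- are limits of the node measures' masses and must equal `m u`, the limit along the whole
  -- sequence.
  set U : Ultrafilter ℕ := Ultrafilter.of atTop with hU
  have hUle : (U : Filter ℕ) ≤ atTop := Ultrafilter.of_le atTop
  obtain ⟨μ, hμ⟩ : ∃ μ, Tendsto (fun n => nodeMeasure (x n)) U (𝓝 μ) :=
    ⟨(U.map fun n => nodeMeasure (x n)).lim, (U.map fun n => nodeMeasure (x n)).le_nhds_lim⟩
  refine ⟨μ, hcard, fun u => ?_⟩
  have h1 : Tendsto (fun n => (nodeMeasure (x n) : Measure Ends).real (cyl u)) U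
      (𝓝 ((μ : Measure Ends).real (cyl u))) :=
    NNReal.tendsto_coe.2
      (ProbabilityMeasure.tendsto_measure_of_isClopen_of_tendsto hμ (isClopen_cyl u))
  have h2 : Tendsto (fun n => (nodeMeasure (x n) : Measure Ends).real (cyl u) -
      (subtreeSize (x n) u : ℝ) / (x n).nodes.card) atTop (𝓝 0) :=
    squeeze_zero_norm (fun n => abs_nodeMeasure_sub_le (x n) u)
      ((tendsto_natCast_atTop_atTop.comp hcard).const_div_atTop _)
  have h3 := h2.add (hm u)
  simp only [sub_add_cancel, zero_add] at h3
  rw [tendsto_nhds_unique h1 (h3.mono_left hUle)]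
  exact hm u

/-! ### Almost sure convergence of the chain -/

section Limit

variable {Ω : Type*} {mΩ : MeasurableSpace Ω} {P : Measure Ω} [IsProbabilityMeasure P]
  {X : ℕ → Ω → BinTree}

theorem urnShare_nonneg (a b : ℕ) : 0 ≤ urnShare a b := by unfold urnShare; positivity

theorem IsBSTChain.ae_urnsConverge (hX : IsBSTChain P X) :
    ∀ᵐ ω ∂P, UrnsConverge (fun n => X (n + 1) ω) := by
  have key : ∀ (φ : ℕ → ℕ → ℝ), (∀ a b, 0 ≤ φ a b) →
      (∀ a b : ℕ, ((a : ℝ) + 1) * φ (a + 1) b + (b + 1) * φ a (b + 1) = (a + b + 2) * φ a b) →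
      ∀ᵐ ω ∂P, ∀ u : Node, ∃ c, Tendsto (fun n => φ (subtreeSize (X (n + 1) ω) (u ++ [false]))
        (subtreeSize (X (n + 1) ω) (u ++ [true]))) atTop (𝓝 c) := by
    intro φ h0 hφ
    rw [ae_all_iff]
    intro u
    have hm := hX.martingale (g := fun x => φ (subtreeSize x (u ++ [false]))
      (subtreeSize x (u ++ [true]))) (fun x => sum_urn_eq_zero hφ x u)
    exact Martingale.ae_tendsto_of_nonneg hm (fun _ _ => h0 _ _)
  have h1 := key urnShare urnShare_nonneg urnShare_harmonic
  -- Since `urnLog ≤ 1`, this is a nonnegative martingale and converges without a moment bound.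
  have h2 := key (fun a b => 1 - urnLog a b) (fun a b => sub_nonneg.2 (urnLog_le_one a b))
    (fun a b => by linarith [urnLog_harmonic a b])
  filter_upwards [hX.ae_card, h1, h2] with ω h0 h1 h2
  refine ⟨h0, h1, fun u => ?_⟩
  obtain ⟨c, hc⟩ := h2 u
  exact ⟨1 - c, by simpa using hc.const_sub 1⟩

theorem doobMartinTendsto_shift {x : ℕ → BinTree} {μ : ProbabilityMeasure Ends} :
    DoobMartinTendsto (fun n => x (n + 1)) μ ↔ DoobMartinTendsto x μ :=
  and_congr (tendsto_add_atTop_iff_nat (f := fun n => (x n).nodes.card) 1) (forall_congr' fun u =>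
    tendsto_add_atTop_iff_nat
      (f := fun n => (subtreeSize (x n) u : ℝ) / ((x n).nodes.card : ℝ)) 1)

theorem IsBSTChain.exists_limit (hX : IsBSTChain P X) :
    ∃ Xinf : Ω → ProbabilityMeasure Ends, Measurable Xinf ∧
      ∀ᵐ ω ∂P, DoobMartinTendsto (fun n => X n ω) (Xinf ω) := by
  classical
  obtain ⟨G, hGP, hGm, hG⟩ := hX.ae_urnsConverge.exists_measurable_mem
  -- A fixed value off the measurable good set makes the cylinder masses everywhere limits of
  -- measurable functions, so the choice of `μ` is measurable.
  have hex : ∀ ω, ∃ μ : ProbabilityMeasure Ends,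
      if ω ∈ G then DoobMartinTendsto (fun n => X (n + 1) ω) μ else μ = default := by
    intro ω
    split_ifs with h
    · have hx := hG ω h
      choose m hm using hx.exists_tendsto
      exact exists_doobMartinTendsto hx.tendsto_card (fun u => (hm u).2)
    · exact ⟨default, rfl⟩
  choose Xinf hXinf using hex
  refine ⟨Xinf, measurable_of_measurable_cyl (fun u => ?_), ?_⟩
  · refine measurable_of_tendsto_metrizable (f := fun n ω => if ω ∈ G then
      (subtreeSize (X (n + 1) ω) u : ℝ) / ((X (n + 1) ω).nodes.card : ℝ) else
      ((default : ProbabilityMeasure Ends) : Measure Ends).real (cyl u)) (fun n => ?_) ?_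
    · exact Measurable.ite hGm ((measurable_from_top
        (f := fun x : BinTree => (subtreeSize x u : ℝ) / (x.nodes.card : ℝ))).comp
          (hX.measurable (n + 1) (by omega))) measurable_const
    · refine tendsto_pi_nhds.2 (fun ω => ?_)
      have h := hXinf ω
      by_cases hω : ω ∈ G
      · simp only [if_pos hω] at h ⊢
        exact h.2 u
      · simp only [if_neg hω] at h ⊢
        rw [h]
        exact tendsto_const_nhds
  · filter_upwards [hGP] with ω hω
    have h := hXinf ω
    rw [if_pos hω] at h
    exact doobMartinTendsto_shift.1 h

/-! ### The martingale limit and its identification with the series. -/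

theorem IsBSTChain.uniformIntegrable_levelDev (hX : IsBSTChain P X) (k : ℕ) :
    UniformIntegrable (fun n ω => levelDev k (X (n + 1) ω)) 1 P :=
  uniformIntegrable_of_lintegral_sq_le
    (fun n => (hX.integrable (levelDev k) n).aestronglyMeasurable)
    ENNReal.ofReal_ne_top (hX.lintegral_levelDev_sq_le k)

theorem IsBSTChain.exists_limitDev (hX : IsBSTChain P X) : ∃ f : Ω → ℝ, Measurable f ∧
    ∀ᵐ ω ∂P, Tendsto (fun n => levelDev 0 (X (n + 1) ω)) atTop (𝓝 (f ω)) :=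
  let ⟨_, hR⟩ := (hX.uniformIntegrable_levelDev 0).2.2
  measurable_limit_of_tendsto_metrizable_ae (fun n => (hX.integrable (levelDev 0) n).aemeasurable)
    ((hX.martingale (sum_levelDev_addNode 0)).submartingale.exists_ae_tendsto_of_bdd hR)

/-- The almost sure limit of `L (X n) - H n`. -/
def limitDev (hX : IsBSTChain P X) : Ω → ℝ := hX.exists_limitDev.choose

theorem IsBSTChain.ae_tendsto_limitDev (hX : IsBSTChain P X) :
    ∀ᵐ ω ∂P, Tendsto (fun n => levelDev 0 (X (n + 1) ω)) atTop (𝓝 (limitDev hX ω)) :=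
  hX.exists_limitDev.choose_spec.2

theorem IsBSTChain.memLp_limitDev (hX : IsBSTChain P X) : MemLp (limitDev hX) 2 P := by
  refine ⟨hX.exists_limitDev.choose_spec.1.aestronglyMeasurable, lt_of_le_of_lt
    (eLpNorm_le_of_ae_tendsto (fun n => (hX.integrable (levelDev 0) n).aestronglyMeasurable)
      (hX.eLpNorm_levelDev_le 0) hX.ae_tendsto_limitDev) ?_⟩
  exact ENNReal.rpow_lt_top_of_nonneg (by norm_num) ENNReal.ofReal_ne_top

variable {Xinf : Ω → ProbabilityMeasure Ends}

/-- This realises the error of the `k`-th partial sum as an almost sure limit of remainders, through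
which the uniform second moment bound is transferred. -/
theorem IsBSTChain.ae_tendsto_levelDev (hX : IsBSTChain P X)
    (hXinf : ∀ᵐ ω ∂P, DoobMartinTendsto (fun n => X n ω) (Xinf ω)) (k : ℕ) :
    ∀ᵐ ω ∂P, Tendsto (fun n => -levelDev k (X (n + 1) ω)) atTop
      (𝓝 (partialL (Xinf ω) k - limitDev hX ω)) := by
  filter_upwards [hXinf, hX.ae_urnsConverge, hX.ae_tendsto_limitDev] with ω h1 h2 h3
  have := (h2.tendsto_levelDev_sub (doobMartinTendsto_shift.2 h1) k).sub h3
  refine this.congr (fun n => ?_)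
  ring

theorem IsBSTChain.aestronglyMeasurable_partialL_sub (hX : IsBSTChain P X)
    (hXinf : ∀ᵐ ω ∂P, DoobMartinTendsto (fun n => X n ω) (Xinf ω)) (k : ℕ) :
    AEStronglyMeasurable (fun ω => partialL (Xinf ω) k - limitDev hX ω) P :=
  aestronglyMeasurable_of_tendsto_ae atTop
    (fun n => (hX.integrable (fun x => -levelDev k x) n).aestronglyMeasurable)
    (hX.ae_tendsto_levelDev hXinf k)

theorem IsBSTChain.eLpNorm_partialL_sub_le (hX : IsBSTChain P X)
    (hXinf : ∀ᵐ ω ∂P, DoobMartinTendsto (fun n => X n ω) (Xinf ω)) (k : ℕ) :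
    eLpNorm (fun ω => partialL (Xinf ω) k - limitDev hX ω) 2 P ≤
      ENNReal.ofReal (2 * 2⁻¹ ^ k) ^ (1 / 2 : ℝ) := by
  refine eLpNorm_le_of_ae_tendsto
    (fun n => (hX.integrable (fun x => -levelDev k x) n).aestronglyMeasurable) (fun n => ?_)
    (hX.ae_tendsto_levelDev hXinf k)
  have : (fun ω => -levelDev k (X (n + 1) ω)) = -(fun ω => levelDev k (X (n + 1) ω)) := rfl
  rw [this, eLpNorm_neg]
  exact hX.eLpNorm_levelDev_le k n

theorem tendsto_two_mul_inv_pow : Tendsto (fun k : ℕ => (2 : ℝ) * 2⁻¹ ^ k) atTop (𝓝 0) := by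
  simpa using (tendsto_pow_atTop_nhds_zero_of_lt_one (r := (2⁻¹ : ℝ)) (by norm_num)
    (by norm_num)).const_mul 2

theorem IsBSTChain.tendsto_eLpNorm_partialL_sub (hX : IsBSTChain P X)
    (hXinf : ∀ᵐ ω ∂P, DoobMartinTendsto (fun n => X n ω) (Xinf ω)) :
    Tendsto (fun k => eLpNorm (fun ω => partialL (Xinf ω) k - limitDev hX ω) 2 P) atTop (𝓝 0) := by
  refine tendsto_of_tendsto_of_tendsto_of_le_of_le tendsto_const_nhds ?_ (fun _ => zero_le)
    (hX.eLpNorm_partialL_sub_le hXinf)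
  have h := (ENNReal.continuous_rpow_const (y := (1 / 2 : ℝ))).continuousAt.tendsto.comp
    (ENNReal.tendsto_ofReal tendsto_two_mul_inv_pow)
  simpa [Function.comp_def] using h

theorem IsBSTChain.ae_tendsto_partialL (hX : IsBSTChain P X)
    (hXinf : ∀ᵐ ω ∂P, DoobMartinTendsto (fun n => X n ω) (Xinf ω)) :
    ∀ᵐ ω ∂P, Tendsto (fun k => partialL (Xinf ω) k) atTop (𝓝 (limitDev hX ω)) := by
  have hs : Summable (fun k : ℕ => (2 : ℝ) * 2⁻¹ ^ k) :=
    (summable_geometric_of_lt_one (by norm_num) (by norm_num)).mul_left 2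
  have h := ae_tendsto_zero_of_lintegral_sq_le (hX.aestronglyMeasurable_partialL_sub hXinf)
    (K := fun k => ENNReal.ofReal (2 * 2⁻¹ ^ k)) hs.tsum_ofReal_ne_top (fun k => ?_)
  · filter_upwards [h] with ω hω
    exact tendsto_sub_nhds_zero_iff.1 hω
  · have h1 := hX.eLpNorm_partialL_sub_le hXinf k
    rw [eLpNorm_eq_lintegral_rpow_enorm_toReal (by simp) (by simp)] at h1
    exact (ENNReal.rpow_le_rpow_iff (by norm_num)).1 h1

theorem IsBSTChain.ae_levelDev_zero (hX : IsBSTChain P X) :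
    ∀ᵐ ω ∂P, ∀ n, levelDev 0 (X (n + 1) ω) = L (X (n + 1) ω) - (harmonic (n + 1) : ℝ) := by
  filter_upwards [hX.ae_card] with ω hω n
  rw [levelDev_zero, hω n]

/-- Uniform integrability upgrades almost sure convergence to `L¹`, so the martingale is closed by
its limit. -/
theorem IsBSTChain.condExp_limitDev (hX : IsBSTChain P X) {n : ℕ} (hn : 1 ≤ n) :
    condExp (natSigma X n) P (limitDev hX) =ᵐ[P] fun ω => L (X n ω) - (harmonic n : ℝ) := by
  obtain ⟨m, rfl⟩ := Nat.exists_eq_add_of_le' hn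
  have hL := hX.memLp_limitDev.mono_exponent (p := 1) (by norm_num)
  have hu := hX.uniformIntegrable_levelDev 0
  filter_upwards [(hX.martingale (sum_levelDev_addNode 0)).eq_condExp_of_tendsto_eLpNorm
    (hL.integrable le_rfl) (tendsto_Lp_finite_of_tendsto_ae le_rfl (by simp) hu.1 hL hu.2.1
      hX.ae_tendsto_limitDev) m, hX.ae_levelDev_zero] with ω h1 h2
  rw [← h2 m]
  exact h1.symm

end Limit

end BST

end

theorem mainTheorem2 {Ω : Type*} [MeasurableSpace Ω] (P : Measure Ω) [IsProbabilityMeasure P]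
    (X : ℕ → Ω → BST.BinTree) (hX : BST.IsBSTChain P X) :
    (∃ Xinf : Ω → ProbabilityMeasure BST.Ends, Measurable Xinf ∧
      ∀ᵐ ω ∂P, BST.DoobMartinTendsto (fun n => X n ω) (Xinf ω)) ∧
    ∀ Xinf : Ω → ProbabilityMeasure BST.Ends,
      (∀ᵐ ω ∂P, BST.DoobMartinTendsto (fun n => X n ω) (Xinf ω)) →
      (∀ᵐ ω ∂P, ∀ u : BST.Node, 0 < (Xinf ω : Measure BST.Ends) (BST.cyl u)) ∧
      ∃ Linf : Ω → ℝ, MemLp Linf 2 P ∧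
        (∀ᵐ ω ∂P, Tendsto (fun k => BST.partialL (Xinf ω) k) atTop (𝓝 (Linf ω))) ∧
        Tendsto (fun k => eLpNorm (fun ω => BST.partialL (Xinf ω) k - Linf ω) 2 P) atTop (𝓝 0) ∧
        (∀ n : ℕ, 1 ≤ n →
          condExp (BST.natSigma X n) P Linf =ᵐ[P]
            fun ω => BST.L (X n ω) - (harmonic n : ℝ)) ∧
        ∀ᵐ ω ∂P, Tendsto (fun n => BST.L (X n ω) - (harmonic n : ℝ)) atTop (𝓝 (Linf ω)) := by
  refine ⟨hX.exists_limit, fun Xinf hXinf => ⟨?_, BST.limitDev hX, hX.memLp_limitDev,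
    hX.ae_tendsto_partialL hXinf, hX.tendsto_eLpNorm_partialL_sub hXinf,
    fun n hn => hX.condExp_limitDev hn, ?_⟩⟩
  · filter_upwards [hXinf, hX.ae_urnsConverge] with ω h1 h2 u
    exact (ENNReal.toReal_pos_iff.1
      (h2.pos_of_doobMartinTendsto (BST.doobMartinTendsto_shift.2 h1) u)).1
  · filter_upwards [hX.ae_tendsto_limitDev, hX.ae_levelDev_zero] with ω h1 h2
    rw [← tendsto_add_atTop_iff_nat 1]
    exact h1.congr h2
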